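/- A \emph{nice Young function} is an even convex function $\Phi:\mathbb R\to[0,\infty)$ that vanishes exactly at $0$ and satisfies $\Phi'(0)=0$, $\Phi(x)\to+\infty$ and $\Phi(x)/x\to+\infty$ as $x\to+\infty$. Its \emph{modification} is the function $H_\Phi:\mathbb R\to[0,\infty)$ with $H_\Phi(x)=x^2$ if $|x|\le 1$ and $H_\Phi(x)=\Phi(|x|)/\Phi(1)$ if $|x|>1$. For a probability measure $\mu$ on $\mathbb R$ and a measurable $g\ge 0$, let $\mathrm{Ent}_\mu(g)=\int g\log g\,d\mu-\left(\int g\,d\mu\right)\log\left(\int g\,d\mu\right)$ (with $0\log 0=0$), understood as $+\infty$ if $g$ or $g\log g$ is not $\mu$-integrable. \textbf{Theorem.} Let $\Phi$ be a strictly convex differentiable nice Young function. Assume that $\Phi(x)/x^2$ is non-decreasing on $(0,\infty)$ and that $\theta>2$ is such that $\Phi(x)/x^\theta$ is non-increasing on $(0,\infty)$. Let $V:\mathbb R\to\mathbb R$ be measurable and locally bounded, of class $\mathcal C^2$ in neighborhoods of $+\infty$ and $-\infty$, and such that $d\mu(x)=e^{-V(x)}\,dx$ is a probability measure on $\mathbb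 R$. Assume that \begin{enumerate} \item[(i)] $\displaystyle\liminf_{|x|\to+\infty}\mathrm{sign}(x)V'(x)>0$, \item[(ii)] $\displaystyle -1<\liminf_{|x|\to+\infty}\frac{V''(x)}{V'(x)^2}\le\limsup_{|x|\to+\infty}\frac{V''(x)}{V'(x)^2}<\frac1\theta$, \item[(iii)] $\displaystyle\limsup_{|x|\to+\infty}\frac{V(x)}{\Phi(|V'(x)|)}<+\infty$. \end{enumerate} Then there exists a constant $\kappa\in(0,\infty)$ such that for every locally Lipschitz $f:\mathbb R\to\mathbb R$, $$\mathrm{Ent}_\mu(f^2)\le\kappa\int_{\mathbb R}H_\Phi\left(\frac{f'}{f}\right)f^2\,d\mu ,$$ where the right-hand side may be $+\infty$ and its integrand is read as $0$ where $f=0$. -/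

import Mathlib

open Set Filter Topology MeasureTheory

/-- A nice Young function: a finite, even, convex function `Φ : ℝ → [0, ∞)` with `Φ 0 = 0`,
`Φ x → ∞` and `Φ x / x → ∞` as `x → ∞`, `Φ' 0 = 0`, vanishing only at `0`. -/
structure IsNiceYoung (Φ : ℝ → ℝ) : Prop where
  nonneg : ∀ x, 0 ≤ Φ x
  even : ∀ x, Φ (-x) = Φ x
  convex : ConvexOn ℝ univ Φ
  eq_zero_iff : ∀ x, Φ x = 0 ↔ x = 0
  tendsto_atTop : Tendsto Φ atTop atTop
  hasDerivAt_zero : HasDerivAt Φ 0 0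
  tendsto_div_atTop : Tendsto (fun x => Φ x / x) atTop atTop

/-- The modification `H_Φ` of `Φ`: `x ^ 2` when `|x| ≤ 1` and `Φ |x| / Φ 1` when `|x| > 1`. -/
noncomputable def modification (Φ : ℝ → ℝ) (x : ℝ) : ℝ :=
  if |x| ≤ 1 then x ^ 2 else Φ |x| / Φ 1

/-- The entropy `∫ g log g dμ - (∫ g dμ) log (∫ g dμ)` of a nonnegative function `g` with respect
to a probability measure `μ`. It is `+∞` when `g` or `g log g` is not `μ`-integrable (for integrable
`g ≥ 0` the negative part of `g log g` is bounded, so the latter means `∫ g log g dμ = +∞`). -/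
noncomputable def entropy (μ : Measure ℝ) (g : ℝ → ℝ) : EReal :=
  open Classical in
  if Integrable g μ ∧ Integrable (fun x => g x * Real.log (g x)) μ then
    (((∫ x, g x * Real.log (g x) ∂μ) - (∫ x, g x ∂μ) * Real.log (∫ x, g x ∂μ) : ℝ) : EReal)
  else ⊤

/-- `μ` satisfies a modified logarithmic Sobolev inequality with function `H`: for some
`κ ∈ (0, ∞)`, `Ent_μ (f²) ≤ κ ∫ H (f' / f) f² dμ` for every locally Lipschitz `f : ℝ → ℝ`.
The right-hand side is a Lebesgue integral in `[0, ∞]`. A locally Lipschitz `f` is differentiable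
Lebesgue-a.e., and the integrand is read as `0` where `f` vanishes (where `f' = 0` a.e.). -/
def ModifiedLogSobolev (μ : Measure ℝ) (H : ℝ → ℝ) : Prop :=
  ∃ κ : ℝ, 0 < κ ∧ ∀ f : ℝ → ℝ, LocallyLipschitz f →
    entropy μ (fun x => f x ^ 2) ≤
      ((ENNReal.ofReal κ * ∫⁻ x, ENNReal.ofReal (H (deriv f x / f x) * f x ^ 2) ∂μ : ENNReal) :
        EReal)

/-- The measure `e^{-V(x)} dx` on the real line. -/
noncomputable def expMeasure (V : ℝ → ℝ) : Measure ℝ :=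
  volume.withDensity (fun x => ENNReal.ofReal (Real.exp (-V x)))

/-! For every `σ > 0` the entropy of `f²` is at most the integral of `entropyGap σ f`, so no
centring of `f` is needed, only a good level `σ`. If the energy is at most `τ²`, then `∫ f'² dμ ≤
τ²`, because `x² ≤ H_Φ x`. Take `σ` equal to `|f A|` plus a multiple of `τ`, large enough that `|f|
≤ σ` on `[-A, A]`. There the gap is `O(τ²)` by Cauchy-Schwarz.

On a tail the gap is handled in two regimes. Where `|f| ≤ 2σ` it is at most `9 (|f| - σ)²`, and the
Hardy inequality `lintegral_sub_sq_le`, a consequence of `V' ≥ c`, applies. Where `|f| ≥ 2σ` it is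
at most `f² log (f²/σ²)`. Cauchy-Schwarz gives `|f - f A|² ≤ τ² e^V / c`, so the logarithm is at
most a constant plus `V`, hence `O(Φ(V'))` by assumption (iii).

What remains is a Hardy inequality with weight `Φ(V')`, `lintegral_young_cutoffSq_le`. It comes from
integrating the derivative of `Φ(V')/V' · e^{-V} · ψ(g)`, where `g = max |f| σ` and `ψ = cutoffSq σ
n`. The bound `V'' ≤ V'²/θ` together with `y Φ' y ≤ θ Φ y` makes the derivative of `Φ(V')/V' ·
e^{-V}` at most `-Φ(V') e^{-V}/θ`. The term with `ψ'` is absorbed by a Young-type inequality. -/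

/-! ### Integration by parts and weighted Cauchy-Schwarz -/

/-- If `X ≤ Y + v'` almost everywhere on `(a, b]` with `v` absolutely continuous, then the integral
of `X` is at most that of `Y` plus the increment of `v`. -/
theorem setLIntegral_Ioc_le_of_le_add_deriv {v X Y : ℝ → ℝ} {a b : ℝ} (hab : a ≤ b)
    (hv : AbsolutelyContinuousOnInterval v a b)
    (hY : AEMeasurable Y (volume.restrict (Ioc a b)))
    (hX0 : ∀ x ∈ Ioc a b, 0 ≤ X x) (hY0 : ∀ x ∈ Ioc a b, 0 ≤ Y x)
    (h : ∀ᵐ x ∂volume.restrict (Ioc a b), X x ≤ Y x + deriv v x) :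
    ∫⁻ x in Ioc a b, ENNReal.ofReal (X x) ≤
      (∫⁻ x in Ioc a b, ENNReal.ofReal (Y x)) + ENNReal.ofReal (v b - v a) := by
  by_cases hfin : ∫⁻ x in Ioc a b, ENNReal.ofReal (Y x) = ⊤
  · simp [hfin]
  have hY0' : 0 ≤ᵐ[volume.restrict (Ioc a b)] Y :=
    (ae_restrict_iff' measurableSet_Ioc).2 (Eventually.of_forall hY0)
  have hX0' : ∀ᵐ x ∂volume.restrict (Ioc a b), 0 ≤ X x :=
    (ae_restrict_iff' measurableSet_Ioc).2 (Eventually.of_forall hX0)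
  have hYi : Integrable Y (volume.restrict (Ioc a b)) := by
    refine ⟨hY.aestronglyMeasurable, ?_⟩
    rw [hasFiniteIntegral_iff_ofReal hY0']
    exact lt_top_iff_ne_top.2 hfin
  have hvi : Integrable (deriv v) (volume.restrict (Ioc a b)) :=
    (intervalIntegrable_iff_integrableOn_Ioc_of_le hab).1 hv.intervalIntegrable_deriv
  have hint : ∫ x in Ioc a b, deriv v x = v b - v a := by
    rw [← intervalIntegral.integral_of_le hab, hv.integral_deriv_eq_sub]
  calc ∫⁻ x in Ioc a b, ENNReal.ofReal (X x)
      ≤ ∫⁻ x in Ioc a b, ENNReal.ofReal (Y x + deriv v x) :=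
        lintegral_mono_ae (h.mono fun x hx => ENNReal.ofReal_le_ofReal hx)
    _ = ENNReal.ofReal (∫ x in Ioc a b, (Y x + deriv v x)) := by
        refine (ofReal_integral_eq_lintegral_ofReal (f := fun x => Y x + deriv v x)
          (hYi.add hvi) ?_).symm
        filter_upwards [h, hX0'] with x h1 h2 using h2.trans h1
    _ = ENNReal.ofReal ((∫ x in Ioc a b, Y x) + (v b - v a)) := by
        rw [integral_add hYi hvi, hint]
    _ ≤ ENNReal.ofReal (∫ x in Ioc a b, Y x) + ENNReal.ofReal (v b - v a) :=
        ENNReal.ofReal_add_le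
    _ = _ := by rw [ofReal_integral_eq_lintegral_ofReal hYi hY0']

/-- A half-line integration by parts: if `X + u' ≤ Y` almost everywhere on `(a, ∞)` where `u` is
locally absolutely continuous and is smallest at `a`, then `∫ X ≤ ∫ Y`. -/
theorem setLIntegral_Ioi_le_of_add_deriv_le {u X Y : ℝ → ℝ} {a : ℝ}
    (hu : ∀ b, a ≤ b → AbsolutelyContinuousOnInterval u a b)
    (hle : ∀ b, a ≤ b → u a ≤ u b)
    (hY : AEMeasurable Y (volume.restrict (Ioi a)))
    (hX0 : ∀ x ∈ Ioi a, 0 ≤ X x) (hY0 : ∀ x ∈ Ioi a, 0 ≤ Y x)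
    (h : ∀ᵐ x ∂volume.restrict (Ioi a), X x + deriv u x ≤ Y x) :
    ∫⁻ x in Ioi a, ENNReal.ofReal (X x) ≤ ∫⁻ x in Ioi a, ENNReal.ofReal (Y x) := by
  have hU : Ioi a = ⋃ n : ℕ, Ioc a (a + n) := by
    ext x
    simp only [mem_Ioi, mem_iUnion, mem_Ioc]
    constructor
    · intro hx
      obtain ⟨n, hn⟩ := exists_nat_ge (x - a)
      exact ⟨n, hx, by linarith⟩
    · rintro ⟨n, hx, -⟩
      exact hx
  have hdir : Directed (· ⊆ ·) fun n : ℕ => Ioc a (a + n) := by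
    refine Monotone.directed_le (f := fun n : ℕ => Ioc a (a + n)) fun m n hmn => ?_
    refine Ioc_subset_Ioc_right ?_
    have : (m : ℝ) ≤ n := by exact_mod_cast hmn
    linarith
  conv_lhs => rw [hU]
  rw [setLIntegral_iUnion_of_directed _ hdir]
  refine iSup_le fun n => ?_
  have hn : a ≤ a + n := by simp
  have hsub : Ioc a (a + n) ⊆ Ioi a := Ioc_subset_Ioi_self
  have key := setLIntegral_Ioc_le_of_le_add_deriv (v := fun x => -u x) (X := X) (Y := Y) hn
    (hu _ hn).fun_neg (hY.mono_measure (Measure.restrict_mono hsub le_rfl))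
    (fun x hx => hX0 x (hsub hx)) (fun x hx => hY0 x (hsub hx))
    (by
      filter_upwards [ae_restrict_of_ae_restrict_of_subset hsub h] with x hx
      rw [deriv.fun_neg]
      linarith)
  -- The boundary term has a favourable sign on each bounded interval, so no limit of `u` at
  -- infinity is needed.
  have h0 : ENNReal.ofReal (-u (a + n) - -u a) = 0 :=
    ENNReal.ofReal_of_nonpos (by linarith [hle _ hn])
  rw [h0, add_zero] at key
  exact key.trans (lintegral_mono_set hsub)

/-- A weighted Cauchy-Schwarz bound for the increment of an absolutely continuous function. -/
theorem abs_sub_le_of_setLIntegral_deriv_sq_le {f p : ℝ → ℝ} {a b τ L : ℝ} (hab : a ≤ b)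
    (hτ : 0 < τ) (hL : 0 < L)
    (hf : AbsolutelyContinuousOnInterval f a b)
    (hp : ∀ x ∈ Ioc a b, 0 < p x)
    (hpm : AEMeasurable p (volume.restrict (Ioc a b)))
    (h1 : ∫⁻ x in Ioc a b, ENNReal.ofReal (deriv f x ^ 2 * p x) ≤ ENNReal.ofReal (τ ^ 2))
    (h2 : ∫⁻ x in Ioc a b, ENNReal.ofReal ((p x)⁻¹) ≤ ENNReal.ofReal (L ^ 2)) :
    |f b - f a| ≤ τ * L := by
  have hfi : IntegrableOn (deriv f) (Ioc a b) :=
    (intervalIntegrable_iff_integrableOn_Ioc_of_le hab).1 hf.intervalIntegrable_deriv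
  have hint : f b - f a = ∫ x in Ioc a b, deriv f x := by
    rw [← intervalIntegral.integral_of_le hab, hf.integral_deriv_eq_sub]
  have hle : ENNReal.ofReal (∫ x in Ioc a b, |deriv f x|) ≤ ENNReal.ofReal (τ * L) := by
    rw [ofReal_integral_eq_lintegral_ofReal hfi.abs (Eventually.of_forall fun x => abs_nonneg _)]
    calc ∫⁻ x in Ioc a b, ENNReal.ofReal |deriv f x|
        -- AM-GM, with weights chosen so that each of the two integrals contributes `τ L / 2`.
        ≤ ∫⁻ x in Ioc a b, (ENNReal.ofReal (L / (2 * τ)) * ENNReal.ofReal (deriv f x ^ 2 * p x) +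
            ENNReal.ofReal (τ / (2 * L)) * ENNReal.ofReal ((p x)⁻¹)) := by
          refine setLIntegral_mono_ae' measurableSet_Ioc (Eventually.of_forall fun x hx => ?_)
          have hpx := hp x hx
          rw [← ENNReal.ofReal_mul (by positivity), ← ENNReal.ofReal_mul (by positivity),
            ← ENNReal.ofReal_add (by positivity) (by positivity)]
          refine ENNReal.ofReal_le_ofReal ?_
          have e : L / (2 * τ) * (deriv f x ^ 2 * p x) + τ / (2 * L) * (p x)⁻¹ - |deriv f x| =
              (L * p x * |deriv f x| - τ) ^ 2 / (2 * τ * L * p x) := by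
            rw [← sq_abs (deriv f x)]
            field_simp
            ring
          have : 0 ≤ (L * p x * |deriv f x| - τ) ^ 2 / (2 * τ * L * p x) := by positivity
          linarith
      _ = ENNReal.ofReal (L / (2 * τ)) * (∫⁻ x in Ioc a b, ENNReal.ofReal (deriv f x ^ 2 * p x)) +
            ENNReal.ofReal (τ / (2 * L)) * ∫⁻ x in Ioc a b, ENNReal.ofReal ((p x)⁻¹) := by
          have hm : AEMeasurable (fun x => ENNReal.ofReal ((p x)⁻¹)) (volume.restrict (Ioc a b)) :=
            hpm.inv.ennreal_ofReal
          rw [lintegral_add_right' _ (hm.const_mul _),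
            lintegral_const_mul' _ _ ENNReal.ofReal_ne_top,
            lintegral_const_mul' _ _ ENNReal.ofReal_ne_top]
      _ ≤ ENNReal.ofReal (L / (2 * τ)) * ENNReal.ofReal (τ ^ 2) +
            ENNReal.ofReal (τ / (2 * L)) * ENNReal.ofReal (L ^ 2) := by gcongr
      _ = ENNReal.ofReal (τ * L) := by
          rw [← ENNReal.ofReal_mul (by positivity), ← ENNReal.ofReal_mul (by positivity),
            ← ENNReal.ofReal_add (by positivity) (by positivity)]
          congr 1
          field_simp
          ring
  rw [hint]
  exact (abs_integral_le_integral_abs).trans ((ENNReal.ofReal_le_ofReal_iff (by positivity)).1 hle)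

/-! ### Locally Lipschitz functions and truncation -/

theorem LipschitzOnWith.exists_comp_of_locallyLipschitzOn {φ f : ℝ → ℝ} {a b : ℝ} {s : Set ℝ}
    {K : NNReal} (hφ : LocallyLipschitzOn s φ) (hf : LipschitzOnWith K f (uIcc a b))
    (hs : MapsTo f (uIcc a b) s) : ∃ K', LipschitzOnWith K' (fun x => φ (f x)) (uIcc a b) := by
  obtain ⟨K', hK'⟩ := (hφ.mono hs.image_subset).exists_lipschitzOnWith_of_compact
    (isCompact_uIcc.image_of_continuousOn hf.continuousOn)
  exact ⟨K' * K, hK'.comp hf (mapsTo_image f _)⟩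

theorem LocallyLipschitz.exists_lipschitzOnWith_uIcc {f : ℝ → ℝ} (hf : LocallyLipschitz f)
    (a b : ℝ) : ∃ K, LipschitzOnWith K f (uIcc a b) :=
  (hf.locallyLipschitzOn).exists_lipschitzOnWith_of_compact isCompact_uIcc

theorem LocallyLipschitz.absolutelyContinuousOnInterval {f : ℝ → ℝ} (hf : LocallyLipschitz f)
    (a b : ℝ) : AbsolutelyContinuousOnInterval f a b :=
  (hf.exists_lipschitzOnWith_uIcc a b).choose_spec.absolutelyContinuousOnInterval

theorem LocallyLipschitz.ae_differentiableAt_real {f : ℝ → ℝ} (hf : LocallyLipschitz f) :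
    ∀ᵐ x, DifferentiableAt ℝ f x := by
  have h : ∀ n : ℕ, ∀ᵐ x, x ∈ uIcc (-(n : ℝ)) n → DifferentiableAt ℝ f x := fun n =>
    (hf.absolutelyContinuousOnInterval _ _).ae_differentiableAt
  filter_upwards [ae_all_iff.2 h] with x hx
  obtain ⟨n, hn⟩ := exists_nat_ge |x|
  exact hx n (by rw [uIcc_of_le (by linarith [abs_nonneg x])]; exact abs_le.1 hn)

/-- The derivative vanishes almost everywhere on the zero set. -/
theorem ae_deriv_eq_zero_of_eq_zero (f : ℝ → ℝ) : ∀ᵐ x, f x = 0 → deriv f x = 0 := by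
  -- Only countably many points of the zero set are isolated in it from the right, and a zero with
  -- nonzero derivative is such a point.
  have hc : {x ∈ f ⁻¹' {0} | 𝓝[f ⁻¹' {0} ∩ Ioi x] x = ⊥}.Countable :=
    countable_setOfPred_isolated_right_within
  filter_upwards [measure_eq_zero_iff_ae_notMem.1 (hc.measure_zero volume)] with x hx h0
  by_contra hd
  refine hx ⟨h0, ?_⟩
  have hder : HasDerivAt f (deriv f x) x := (differentiableAt_of_deriv_ne_zero hd).hasDerivAt
  have h1 := hder.eventually_ne (c := 0) hd
  rw [← empty_mem_iff_bot]
  have h2 : ∀ᶠ z in 𝓝[f ⁻¹' {0} ∩ Ioi x] x, f z ≠ 0 :=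
    h1.filter_mono (nhdsWithin_mono _ fun z hz => ne_of_gt hz.2)
  filter_upwards [h2, self_mem_nhdsWithin] with z hz hz'
  exact hz hz'.1

/-- At every point, the derivative of `max |f| σ` is that of `f` up to sign where `σ < |f|`, and
`0` elsewhere. -/
theorem deriv_max_abs_const {f : ℝ → ℝ} (hf : Continuous f) {σ : ℝ} (hσ : 0 < σ) (x : ℝ) :
    |deriv (fun y => max |f y| σ) x| = if σ < |f x| then |deriv f x| else 0 := by
  split_ifs with h
  · have ev : ∀ᶠ y in 𝓝 x, σ < |f y| := hf.abs.continuousAt.eventually (lt_mem_nhds h)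
    rcases lt_or_gt_of_ne (abs_pos.1 (hσ.trans h)) with h0 | h0
    · have ev2 : ∀ᶠ y in 𝓝 x, f y < 0 := hf.continuousAt.eventually (gt_mem_nhds h0)
      have : (fun y => max |f y| σ) =ᶠ[𝓝 x] fun y => -f y := by
        filter_upwards [ev, ev2] with y h1 h2
        rw [max_eq_left h1.le, abs_of_neg h2]
      rw [this.deriv_eq, deriv.fun_neg, abs_neg]
    · have ev2 : ∀ᶠ y in 𝓝 x, 0 < f y := hf.continuousAt.eventually (lt_mem_nhds h0)
      have : (fun y => max |f y| σ) =ᶠ[𝓝 x] f := by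
        filter_upwards [ev, ev2] with y h1 h2
        rw [max_eq_left h1.le, abs_of_pos h2]
      rw [this.deriv_eq]
  -- Where `|f| ≤ σ` the truncation attains its global minimum; this includes the corners `|f x| =
  -- σ`.
  · have : IsLocalMin (fun y => max |f y| σ) x :=
      Eventually.of_forall fun y => by
        simp only [max_eq_right (not_lt.1 h)]
        exact le_max_right _ _
    rw [this.deriv_eq_zero, abs_zero]

/-! ### Young functions between the powers 2 and θ -/

/-- A differentiable nice Young function `Φ` with `Φ x / x ^ 2` non-decreasing and `Φ x / x ^ θ`
non-increasing. -/
structure ControlledYoung (Φ : ℝ → ℝ) (θ : ℝ) : Prop where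
  young : IsNiceYoung Φ
  diff : Differentiable ℝ Φ
  mono : MonotoneOn (fun x : ℝ => Φ x / x ^ 2) (Ioi 0)
  two_lt : 2 < θ
  anti : AntitoneOn (fun x : ℝ => Φ x / x ^ θ) (Ioi 0)

namespace ControlledYoung

variable {Φ : ℝ → ℝ} {θ : ℝ}

theorem pos (h : ControlledYoung Φ θ) {x : ℝ} (hx : x ≠ 0) : 0 < Φ x :=
  (h.young.nonneg x).lt_of_ne fun e => hx ((h.young.eq_zero_iff x).1 e.symm)

theorem map_zero (h : ControlledYoung Φ θ) : Φ 0 = 0 := (h.young.eq_zero_iff 0).2 rfl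

theorem map_abs (h : ControlledYoung Φ θ) (x : ℝ) : Φ |x| = Φ x := by
  rcases abs_choice x with e | e <;> rw [e]
  exact h.young.even x

/-- Monotonicity of `Φ x / x²` with denominators cleared, which admits `x = 0`. -/
theorem mul_sq_le (h : ControlledYoung Φ θ) {x y : ℝ} (hx : 0 ≤ x) (hxy : x ≤ y) :
    Φ x * y ^ 2 ≤ Φ y * x ^ 2 := by
  rcases hx.eq_or_lt with rfl | hx
  · simp [h.map_zero]
  have hy : 0 < y := hx.trans_le hxy
  have := h.mono (mem_Ioi.2 hx) (mem_Ioi.2 hy) hxy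
  simp only at this
  rwa [div_le_div_iff₀ (by positivity) (by positivity)] at this

theorem le_of_le (h : ControlledYoung Φ θ) {x y : ℝ} (hx : 0 ≤ x) (hxy : x ≤ y) : Φ x ≤ Φ y := by
  rcases hx.eq_or_lt with rfl | hx
  · rw [h.map_zero]
    exact h.young.nonneg y
  have h1 := h.mul_sq_le hx.le hxy
  have h2 : Φ y * x ^ 2 ≤ Φ y * y ^ 2 := by
    have := h.young.nonneg y
    gcongr
  have hy : 0 < y := hx.trans_le hxy
  exact le_of_mul_le_mul_right (h1.trans h2) (by positivity)

theorem mul_le_mul (h : ControlledYoung Φ θ) {x y : ℝ} (hx : 0 ≤ x) (hxy : x ≤ y) :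
    Φ x * y ≤ Φ y * x := by
  rcases hx.eq_or_lt with rfl | hx
  · simp [h.map_zero]
  have hy : 0 < y := hx.trans_le hxy
  have h1 := h.mul_sq_le hx.le hxy
  have h2 : Φ y * x ^ 2 ≤ Φ y * x * y := by
    have : 0 ≤ Φ y * x := mul_nonneg (h.young.nonneg y) hx.le
    nlinarith
  exact le_of_mul_le_mul_right (by nlinarith) hy

theorem map_div_le (h : ControlledYoung Φ θ) {ε z : ℝ} (hε : 0 < ε) (hε1 : ε ≤ 1) (hz : 0 ≤ z) :
    Φ (z / ε) ≤ ε ^ (-θ) * Φ z := by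
  rcases hz.eq_or_lt with rfl | hz
  · simp [h.map_zero]
  have hle : z ≤ z / ε := by rw [le_div_iff₀ hε]; nlinarith
  have hd : 0 < z / ε := by positivity
  have := h.anti (mem_Ioi.2 hz) (mem_Ioi.2 hd) hle
  simp only at this
  rw [Real.div_rpow hz.le hε.le, div_le_div_iff₀ (by positivity) (by positivity)] at this
  have hzθ : 0 < z ^ θ := by positivity
  have hεθ : 0 < ε ^ θ := by positivity
  rw [Real.rpow_neg hε.le]
  have h2 : Φ (z / ε) ≤ Φ z / ε ^ θ := by
    rw [le_div_iff₀ hεθ]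
    have e : Φ z * (z ^ θ / ε ^ θ) * ε ^ θ = Φ z * z ^ θ := by field_simp
    have := mul_le_mul_of_nonneg_right this hεθ.le
    rw [e] at this
    exact le_of_mul_le_mul_right (by linarith) hzθ
  rwa [div_eq_inv_mul (Φ z)] at h2

/-- A Young-type inequality. -/
theorem div_mul_le (h : ControlledYoung Φ θ) {ε y z : ℝ} (hε : 0 < ε) (hε1 : ε ≤ 1) (hy : 0 < y)
    (hz : 0 ≤ z) : Φ y / y * z ≤ ε * Φ y + ε ^ (-θ) * Φ z := by
  have hΦy := h.young.nonneg y
  have hΦz := h.young.nonneg z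
  -- A small `z` is absorbed by `ε Φ y`. Otherwise `y ≤ z / ε`, and since `Φ x / x` is
  -- non-decreasing the left side is at most `ε Φ (z / ε)`, which `map_div_le` controls.
  rcases le_total z (ε * y) with hzy | hzy
  · have : Φ y / y * z ≤ Φ y / y * (ε * y) := by gcongr
    have e : Φ y / y * (ε * y) = ε * Φ y := by field_simp
    have : 0 ≤ ε ^ (-θ) * Φ z := by positivity
    linarith
  · have hyz : y ≤ z / ε := by rw [le_div_iff₀ hε]; linarith
    have h1 := h.mul_le_mul hy.le hyz
    have h2 := h.map_div_le hε hε1 hz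
    have h3 : Φ y / y * z ≤ ε * Φ (z / ε) := by
      rw [div_mul_eq_mul_div, div_le_iff₀ hy]
      have := mul_le_mul_of_nonneg_right h1 hε.le
      have e : Φ y * (z / ε) * ε = Φ y * z := by field_simp
      linarith
    have h4 : ε * Φ (z / ε) ≤ 1 * Φ (z / ε) := by
      have := h.young.nonneg (z / ε)
      gcongr
    have : 0 ≤ ε * Φ y := by positivity
    linarith

/-- The sign of the derivative of `Φ x / x²` even gives `2 Φ y ≤ y Φ' y`. This weaker form suffices
to fix the sign of `y Φ' y - Φ y` in the Hardy inequality. -/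
theorem le_mul_deriv (h : ControlledYoung Φ θ) {y : ℝ} (hy : 0 < y) : Φ y ≤ y * deriv Φ y := by
  have hd : HasDerivAt (fun x : ℝ => Φ x / x ^ 2)
      ((deriv Φ y * y ^ 2 - Φ y * (2 * y)) / (y ^ 2) ^ 2) y := by
    have := (h.diff y).hasDerivAt.fun_div (hasDerivAt_pow 2 y) (by positivity)
    simpa using this
  have h0 := h.mono.derivWithin_nonneg (x := y)
  rw [derivWithin_of_isOpen isOpen_Ioi hy, hd.deriv] at h0
  have h1 : 0 ≤ deriv Φ y * y ^ 2 - Φ y * (2 * y) := by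
    by_contra! hc
    exact absurd h0 (not_le.2 (div_neg_of_neg_of_pos hc (by positivity)))
  have h2 : 0 ≤ deriv Φ y * y - Φ y * 2 := by
    by_contra! hc
    nlinarith
  nlinarith [h.young.nonneg y]

theorem mul_deriv_le (h : ControlledYoung Φ θ) {y : ℝ} (hy : 0 < y) :
    y * deriv Φ y ≤ θ * Φ y := by
  have hd : HasDerivAt (fun x : ℝ => Φ x / x ^ θ)
      ((deriv Φ y * y ^ θ - Φ y * (θ * y ^ (θ - 1))) / (y ^ θ) ^ 2) y :=
    (h.diff y).hasDerivAt.fun_div (Real.hasDerivAt_rpow_const (Or.inl hy.ne')) (by positivity)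
  have h0 := h.anti.derivWithin_nonpos (x := y)
  rw [derivWithin_of_isOpen isOpen_Ioi hy, hd.deriv] at h0
  have h1 : deriv Φ y * y ^ θ - Φ y * (θ * y ^ (θ - 1)) ≤ 0 := by
    by_contra! hc
    exact absurd h0 (not_le.2 (by positivity))
  have e : y ^ θ = y ^ (θ - 1) * y := by
    rw [Real.rpow_sub_one hy.ne']
    field_simp
  have hp : 0 < y ^ (θ - 1) := by positivity
  rw [e] at h1
  have : y ^ (θ - 1) * (y * deriv Φ y - θ * Φ y) ≤ 0 := by nlinarith
  by_contra! hc
  nlinarith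

/-- This lower bound on the energy density feeds the `Φ`-weighted Hardy inequality;
`sq_le_modification` feeds the `L²` estimates. -/
theorem le_modification (h : ControlledYoung Φ θ) (x : ℝ) :
    Φ |x| ≤ Φ 1 * modification Φ x := by
  have h1 : 0 < Φ 1 := h.pos one_ne_zero
  unfold modification
  split_ifs with hx
  · have := h.mul_sq_le (abs_nonneg x) hx
    rw [sq_abs] at this
    linarith
  · exact le_of_eq (by field_simp)

theorem sq_le_modification (h : ControlledYoung Φ θ) (x : ℝ) : x ^ 2 ≤ modification Φ x := by
  have h1 : 0 < Φ 1 := h.pos one_ne_zero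
  unfold modification
  split_ifs with hx
  · exact le_rfl
  · have := h.mul_sq_le zero_le_one (not_le.1 hx).le
    rw [le_div_iff₀ h1, ← sq_abs]
    linarith

theorem modification_nonneg (h : ControlledYoung Φ θ) (x : ℝ) : 0 ≤ modification Φ x :=
  (sq_nonneg x).trans (h.sq_le_modification x)

theorem measurable_modification (h : ControlledYoung Φ θ) : Measurable (modification Φ) := by
  unfold modification
  refine Measurable.ite (measurableSet_le measurable_id.abs measurable_const)
    (measurable_id.pow_const 2) ?_
  exact (h.diff.continuous.measurable.comp measurable_id.abs).div_const _

end ControlledYoung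

theorem modification_neg (Φ : ℝ → ℝ) (x : ℝ) : modification Φ (-x) = modification Φ x := by
  simp [modification]

/-! ### The entropy gap -/

/-- The nonnegative function `t ^ 2 log (t ^ 2 / σ ^ 2) - t ^ 2 + σ ^ 2`, whose integral bounds the
entropy. -/
noncomputable def entropyGap (σ t : ℝ) : ℝ := t ^ 2 * Real.log (t ^ 2 / σ ^ 2) - t ^ 2 + σ ^ 2

theorem entropyGap_nonneg {σ : ℝ} (hσ : 0 < σ) (t : ℝ) : 0 ≤ entropyGap σ t := by
  unfold entropyGap
  rcases eq_or_ne t 0 with rfl | ht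
  · simp [sq_nonneg]
  have h1 := Real.one_sub_inv_le_log_of_pos (x := t ^ 2 / σ ^ 2) (by positivity)
  have h2 : t ^ 2 * (1 - (t ^ 2 / σ ^ 2)⁻¹) = t ^ 2 - σ ^ 2 := by field_simp
  have := mul_le_mul_of_nonneg_left h1 (sq_nonneg t)
  linarith

/-- From `log s ≤ s - 1` the gap is at most `(u² - σ²)² / σ²` with `u = |t|`; then `u + σ ≤ 3σ`,
whence `9 = 3²`. -/
theorem entropyGap_le_sq {σ : ℝ} (hσ : 0 < σ) {t : ℝ} (ht : |t| ≤ 2 * σ) :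
    entropyGap σ t ≤ 9 * (|t| - σ) ^ 2 := by
  unfold entropyGap
  rw [← sq_abs t]
  have h0 := abs_nonneg t
  generalize |t| = u at *
  rcases h0.eq_or_lt with rfl | hu
  · simp only [ne_eq, OfNat.ofNat_ne_zero, not_false_eq_true, zero_pow, zero_mul]
    nlinarith [sq_nonneg σ]
  have h1 := Real.log_le_sub_one_of_pos (x := u ^ 2 / σ ^ 2) (by positivity)
  have h2 : u ^ 2 * Real.log (u ^ 2 / σ ^ 2) ≤ u ^ 2 * (u ^ 2 / σ ^ 2 - 1) := by gcongr
  have h3 : u ^ 2 * (u ^ 2 / σ ^ 2 - 1) - u ^ 2 + σ ^ 2 = (u - σ) ^ 2 * ((u + σ) / σ) ^ 2 := by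
    field_simp
    ring
  have h4 : (u + σ) / σ ≤ 3 := by rw [div_le_iff₀ hσ]; linarith
  have h5 : ((u + σ) / σ) ^ 2 ≤ 3 ^ 2 := by gcongr
  have := mul_le_mul_of_nonneg_left h5 (sq_nonneg (u - σ))
  linarith

theorem entropyGap_le_log {σ : ℝ} (hσ : 0 < σ) {t : ℝ} (ht : 2 * σ ≤ |t|) :
    entropyGap σ t ≤ t ^ 2 * Real.log (t ^ 2 / σ ^ 2) := by
  unfold entropyGap
  have : σ ^ 2 ≤ t ^ 2 := by rw [← sq_abs t]; gcongr; linarith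
  linarith

/-- Integrability of the gap thus forces that of `f²`. Beyond `t² = e² σ²` the logarithm is at least
2, so the gap alone dominates `t²`. -/
theorem sq_le_add_entropyGap {σ : ℝ} (hσ : 0 < σ) (t : ℝ) :
    t ^ 2 ≤ Real.exp 2 * σ ^ 2 + entropyGap σ t := by
  rcases le_total (t ^ 2) (Real.exp 2 * σ ^ 2) with h | h
  · linarith [entropyGap_nonneg hσ t]
  · have h1 : 2 ≤ Real.log (t ^ 2 / σ ^ 2) := by
      have h0 : Real.exp 2 ≤ t ^ 2 / σ ^ 2 := by rwa [le_div_iff₀ (by positivity)]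
      rwa [Real.le_log_iff_exp_le ((Real.exp_pos 2).trans_le h0)]
    have h2 := mul_le_mul_of_nonneg_left h1 (sq_nonneg t)
    have h3 := Real.exp_pos 2
    unfold entropyGap
    nlinarith [sq_nonneg σ, mul_nonneg h3.le (sq_nonneg σ)]

theorem measurable_entropyGap (σ : ℝ) : Measurable (entropyGap σ) := by
  unfold entropyGap
  fun_prop

/-! ### The cutoff weight and the pointwise Hardy inequality -/

/-- The weight `t ^ 2 (1 - σ / t) ^ n`: it vanishes at `σ` and is comparable to `t ^ 2` for large
`t`. -/
noncomputable def cutoffSq (σ : ℝ) (n : ℕ) (t : ℝ) : ℝ := t ^ 2 * (1 - σ / t) ^ n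

theorem cutoffSq_nonneg {σ t : ℝ} (hσ : 0 < σ) (n : ℕ) (ht : σ ≤ t) : 0 ≤ cutoffSq σ n t := by
  have h0 : σ / t ≤ 1 := (div_le_one (hσ.trans_le ht)).2 ht
  exact mul_nonneg (sq_nonneg t) (pow_nonneg (by linarith) n)

theorem sq_le_cutoffSq {σ t : ℝ} (hσ : 0 < σ) (n : ℕ) (ht : 2 * σ ≤ t) :
    t ^ 2 ≤ 2 ^ n * cutoffSq σ n t := by
  have h0 : 1 ≤ 2 * (1 - σ / t) := by
    have : σ / t ≤ 1 / 2 := by rw [div_le_div_iff₀ (by linarith) two_pos]; linarith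
    linarith
  have h1 := one_le_pow₀ h0 (n := n)
  rw [mul_pow] at h1
  unfold cutoffSq
  nlinarith [sq_nonneg t]

theorem hasDerivAt_cutoffSq (σ : ℝ) (n : ℕ) {t : ℝ} (ht : t ≠ 0) :
    HasDerivAt (cutoffSq σ n) (2 * t * (1 - σ / t) ^ n + n * σ * (1 - σ / t) ^ (n - 1)) t := by
  have h1 : HasDerivAt (fun t : ℝ => 1 - σ / t) (σ / t ^ 2) t := by
    have := ((hasDerivAt_inv ht).const_mul σ).const_sub 1
    simpa [div_eq_mul_inv] using this
  have h2 := (hasDerivAt_pow 2 t).fun_mul (h1.fun_pow n)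
  refine h2.congr_deriv ?_
  field_simp
  ring

theorem contDiffOn_cutoffSq (σ : ℝ) (n : ℕ) : ContDiffOn ℝ 1 (cutoffSq σ n) (Ioi 0) := by
  unfold cutoffSq
  refine (contDiffOn_id.pow 2).mul ((contDiffOn_const.sub ?_).pow n)
  exact contDiffOn_const.div contDiffOn_id fun x hx => ne_of_gt hx

/-- The pointwise inequality behind the weighted Hardy inequality. -/
theorem ControlledYoung.hardy_pointwise {Φ : ℝ → ℝ} {θ : ℝ} (h : ControlledYoung Φ θ) {n : ℕ}
    (hn : θ ≤ n) {y y' t d p σ : ℝ} (hy : 0 < y) (hy' : y' ≤ y ^ 2 / θ) (hσ : 0 < σ) (ht : σ ≤ t)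
    (hp : 0 < p) :
    (1 / (2 * θ)) * (Φ y * cutoffSq σ n t * p) +
      ((deriv Φ y * y' * (y⁻¹ * p) + Φ y * (-y' / y ^ 2 * p + y⁻¹ * (p * -y))) * cutoffSq σ n t +
        Φ y * (y⁻¹ * p) *
          ((2 * t * (1 - σ / t) ^ n + n * σ * (1 - σ / t) ^ (n - 1)) * d)) ≤
      n * (1 / (2 * θ * n)) ^ (-θ) * (Φ (|d| / t) * t ^ 2 * p) := by
  have hθ := h.two_lt
  have ht0 : 0 < t := hσ.trans_le ht
  have hΦy := h.young.nonneg y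
  have hψ := cutoffSq_nonneg hσ n ht
  have hn2 : (2 : ℝ) < n := hθ.trans_le hn
  have hn2' : 2 < n := by exact_mod_cast hn2
  have hd0 := abs_nonneg d
  have hΦd := h.young.nonneg (|d| / t)
  -- the part without derivative of the weight
  have h1 : (deriv Φ y * y' * (y⁻¹ * p) + Φ y * (-y' / y ^ 2 * p + y⁻¹ * (p * -y))) *
      cutoffSq σ n t ≤ -(1 / θ) * (Φ y * cutoffSq σ n t * p) := by
    -- The lower bound allows `y'` to be replaced by `y²/θ`; the upper bound then leaves `(θ - 1)/θ
    -- - 1 = -1/θ`.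
    have hm0 : 0 ≤ y * deriv Φ y - Φ y := sub_nonneg.2 (h.le_mul_deriv hy)
    have hm1 : y * deriv Φ y - Φ y ≤ (θ - 1) * Φ y := by linarith [h.mul_deriv_le hy]
    have e : deriv Φ y * y' * (y⁻¹ * p) + Φ y * (-y' / y ^ 2 * p + y⁻¹ * (p * -y)) =
        (y' * (y * deriv Φ y - Φ y) / y ^ 2 - Φ y) * p := by
      field_simp
      ring
    have h2 : y' * (y * deriv Φ y - Φ y) / y ^ 2 ≤ (1 - 1 / θ) * Φ y := by
      rw [div_le_iff₀ (by positivity)]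
      calc y' * (y * deriv Φ y - Φ y) ≤ y ^ 2 / θ * (y * deriv Φ y - Φ y) := by gcongr
        _ ≤ y ^ 2 / θ * ((θ - 1) * Φ y) := by gcongr
        _ = (1 - 1 / θ) * Φ y * y ^ 2 := by field_simp
    rw [e]
    calc (y' * (y * deriv Φ y - Φ y) / y ^ 2 - Φ y) * p * cutoffSq σ n t
        ≤ ((1 - 1 / θ) * Φ y - Φ y) * p * cutoffSq σ n t := by gcongr
      _ = _ := by ring
  -- the part with the derivative of the weight
  have h2 : Φ y * (y⁻¹ * p) *
      ((2 * t * (1 - σ / t) ^ n + n * σ * (1 - σ / t) ^ (n - 1)) * d) ≤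
      1 / (2 * θ) * (Φ y * cutoffSq σ n t * p) +
        n * (1 / (2 * θ * n)) ^ (-θ) * (Φ (|d| / t) * t ^ 2 * p) := by
    have hu0 : 0 ≤ 1 - σ / t := by
      have : σ / t ≤ 1 := (div_le_one ht0).2 ht
      linarith
    have hu1 : 1 - σ / t ≤ 1 := by
      have : 0 < σ / t := by positivity
      linarith
    have hσu : σ = t * (1 - (1 - σ / t)) := by field_simp; ring
    unfold cutoffSq at hψ ⊢
    generalize 1 - σ / t = u at *
    rcases hu0.eq_or_lt with rfl | hu0
    · have e1 : (0 : ℝ) ^ n = 0 := zero_pow (by omega)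
      have e2 : (0 : ℝ) ^ (n - 1) = 0 := zero_pow (by omega)
      rw [e1, e2]
      have : 0 ≤ n * (1 / (2 * θ * n)) ^ (-θ) * (Φ (|d| / t) * t ^ 2 * p) := by positivity
      simpa using this
    have eu : u ^ n = u * u ^ (n - 1) := by
      rw [← pow_succ']
      congr 1
      omega
    -- With `σ = t (1 - u)` the bracket is `t u^(n-1) (2u + n (1 - u))`, and `n ≥ 2`.
    have hw : (2 * t * u ^ n + n * σ * u ^ (n - 1)) * d ≤ n * t * u ^ (n - 1) * |d| := by
      have hw0 : 0 ≤ 2 * t * u ^ n + n * σ * u ^ (n - 1) := by positivity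
      have hw1 : 2 * t * u ^ n + n * σ * u ^ (n - 1) ≤ n * t * u ^ (n - 1) := by
        have e : n * t * u ^ (n - 1) - (2 * t * u ^ n + n * σ * u ^ (n - 1)) =
            (n - 2) * (t * u * u ^ (n - 1)) := by
          rw [eu, hσu]
          ring
        have : 0 ≤ ((n : ℝ) - 2) * (t * u * u ^ (n - 1)) :=
          mul_nonneg (by linarith) (by positivity)
        linarith
      calc (2 * t * u ^ n + n * σ * u ^ (n - 1)) * d
          ≤ (2 * t * u ^ n + n * σ * u ^ (n - 1)) * |d| := by gcongr; exact le_abs_self d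
        _ ≤ _ := by gcongr
    -- This `ε` makes `n ε = 1/(2θ)`, half of the gain `1/θ`. Writing `u^(n-1)` as `u^n / u` puts
    -- `|d|/(t u)` into the Young inequality; the resulting factor `u^(-θ)` is absorbed by `u^n`
    -- because `n ≥ θ`.
    have hε : 0 < 1 / (2 * θ * n) := by positivity
    have hε1 : 1 / (2 * θ * n) ≤ 1 := by
      rw [div_le_one (by positivity)]
      nlinarith
    have hY := h.div_mul_le hε hε1 hy (z := |d| / t / u) (by positivity)
    have hsc := h.map_div_le hu0 hu1 (z := |d| / t) (by positivity)
    have hpow : u ^ n * u ^ (-θ) ≤ 1 := by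
      rw [← Real.rpow_natCast, ← Real.rpow_add hu0]
      exact Real.rpow_le_one hu0.le hu1 (by linarith)
    have hεθ : 0 < (1 / (2 * θ * n)) ^ (-θ) := Real.rpow_pos_of_pos hε _
    calc Φ y * (y⁻¹ * p) * ((2 * t * u ^ n + n * σ * u ^ (n - 1)) * d)
        ≤ Φ y * (y⁻¹ * p) * (n * t * u ^ (n - 1) * |d|) := by gcongr
      _ = n * (t ^ 2 * u ^ n) * p * (Φ y / y * (|d| / t / u)) := by
          rw [eu]
          field_simp
      _ ≤ n * (t ^ 2 * u ^ n) * p * (1 / (2 * θ * n) * Φ y +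
            (1 / (2 * θ * n)) ^ (-θ) * (u ^ (-θ) * Φ (|d| / t))) := by gcongr; exact hY.trans (by gcongr)
      _ = 1 / (2 * θ) * (Φ y * (t ^ 2 * u ^ n) * p) +
            n * (1 / (2 * θ * n)) ^ (-θ) * (Φ (|d| / t) * t ^ 2 * p) * (u ^ n * u ^ (-θ)) := by
          have : 1 / (2 * θ * n) * n = 1 / (2 * θ) := by field_simp
          rw [← this]
          ring
      _ ≤ 1 / (2 * θ) * (Φ y * (t ^ 2 * u ^ n) * p) +
            n * (1 / (2 * θ * n)) ^ (-θ) * (Φ (|d| / t) * t ^ 2 * p) * 1 := by gcongr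
      _ = _ := by ring
  have h3 : 1 / θ = 2 * (1 / (2 * θ)) := by field_simp
  rw [h3] at h1
  linarith

/-! ### Hardy inequalities and growth bounds on a tail -/

/-- The assumptions on the potential `V` on the half-line `[A, ∞)`. -/
structure TailPotential (Φ : ℝ → ℝ) (θ c K A : ℝ) (V : ℝ → ℝ) : Prop where
  c_pos : 0 < c
  K_nonneg : 0 ≤ K
  smooth : ∃ A₀ < A, ContDiffOn ℝ 2 V (Ioi A₀)
  le_deriv : ∀ x, A ≤ x → c ≤ deriv V x
  deriv_deriv_le : ∀ x, A ≤ x → deriv (deriv V) x ≤ deriv V x ^ 2 / θ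
  le_young : ∀ x, A ≤ x → V x ≤ K * Φ (deriv V x)

namespace TailPotential

variable {Φ V : ℝ → ℝ} {θ c K A : ℝ}

theorem contDiffAt (hV : TailPotential Φ θ c K A V) {x : ℝ} (hx : A ≤ x) :
    ContDiffAt ℝ 2 V x := by
  obtain ⟨A₀, h0, h⟩ := hV.smooth
  exact h.contDiffAt (Ioi_mem_nhds (h0.trans_le hx))

theorem contDiffAt_deriv (hV : TailPotential Φ θ c K A V) {x : ℝ} (hx : A ≤ x) :
    ContDiffAt ℝ 1 (deriv V) x := by
  obtain ⟨A₀, h0, h⟩ := hV.smooth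
  have := ((contDiffOn_succ_iff_deriv_of_isOpen (n := 1) isOpen_Ioi).1 h).2.2
  exact this.contDiffAt (Ioi_mem_nhds (h0.trans_le hx))

theorem hasDerivAt (hV : TailPotential Φ θ c K A V) {x : ℝ} (hx : A ≤ x) :
    HasDerivAt V (deriv V x) x :=
  ((hV.contDiffAt hx).differentiableAt (by norm_num)).hasDerivAt

theorem hasDerivAt_deriv (hV : TailPotential Φ θ c K A V) {x : ℝ} (hx : A ≤ x) :
    HasDerivAt (deriv V) (deriv (deriv V) x) x :=
  ((hV.contDiffAt_deriv hx).differentiableAt (by norm_num)).hasDerivAt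

theorem continuousOn (hV : TailPotential Φ θ c K A V) : ContinuousOn V (Ici A) :=
  fun _ hx => (hV.hasDerivAt hx).continuousAt.continuousWithinAt

theorem deriv_pos (hV : TailPotential Φ θ c K A V) {x : ℝ} (hx : A ≤ x) : 0 < deriv V x :=
  hV.c_pos.trans_le (hV.le_deriv x hx)

theorem hasDerivAt_exp_neg (hV : TailPotential Φ θ c K A V) {x : ℝ} (hx : A ≤ x) :
    HasDerivAt (fun x => Real.exp (-V x)) (Real.exp (-V x) * -deriv V x) x :=
  (hV.hasDerivAt hx).fun_neg.exp

theorem absolutelyContinuousOnInterval_exp_neg (hV : TailPotential Φ θ c K A V) {b : ℝ}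
    (hb : A ≤ b) : AbsolutelyContinuousOnInterval (fun x => Real.exp (-V x)) A b := by
  refine ContDiffOn.absolutelyContinuousOnInterval fun x hx => ?_
  rw [uIcc_of_le hb] at hx
  exact (((hV.contDiffAt hx.1).of_le one_le_two).neg.exp).contDiffWithinAt

theorem continuousOn_exp_neg (hV : TailPotential Φ θ c K A V) :
    ContinuousOn (fun x => Real.exp (-V x)) (Ici A) :=
  hV.continuousOn.neg.rexp

theorem aemeasurable_exp_neg (hV : TailPotential Φ θ c K A V) :
    AEMeasurable (fun x => Real.exp (-V x)) (volume.restrict (Ioi A)) :=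
  (hV.continuousOn_exp_neg.mono Ioi_subset_Ici_self).aemeasurable measurableSet_Ioi

/-- The Hardy inequality for `f - f A` on a half-line. -/
theorem lintegral_sub_sq_le (hV : TailPotential Φ θ c K A V) {f : ℝ → ℝ}
    (hf : LocallyLipschitz f) :
    ∫⁻ x in Ioi A, ENNReal.ofReal ((f x - f A) ^ 2 * Real.exp (-V x)) ≤
      ENNReal.ofReal (4 / c ^ 2) *
        ∫⁻ x in Ioi A, ENNReal.ofReal (deriv f x ^ 2 * Real.exp (-V x)) := by
  have hc := hV.c_pos
  have hD : LocallyLipschitz fun x => f x - f A := by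
    intro x
    obtain ⟨K, t, ht, h⟩ := hf x
    refine ⟨K, t, ht, fun x hx y hy => ?_⟩
    simpa [edist_dist, Real.dist_eq] using h hx hy
  have key := setLIntegral_Ioi_le_of_add_deriv_le (a := A)
    (u := fun x => (f x - f A) * (f x - f A) * Real.exp (-V x))
    (X := fun x => c / 2 * ((f x - f A) ^ 2 * Real.exp (-V x)))
    (Y := fun x => 2 / c * (deriv f x ^ 2 * Real.exp (-V x)))
    (fun b hb => ((hD.absolutelyContinuousOnInterval A b).fun_mul
      (hD.absolutelyContinuousOnInterval A b)).fun_mul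
      (hV.absolutelyContinuousOnInterval_exp_neg hb))
    (fun b hb => by
      have := Real.exp_pos (-V b)
      simp only [sub_self, zero_mul]
      exact mul_nonneg (mul_self_nonneg _) this.le)
    ((((measurable_deriv f).pow_const 2).aemeasurable.mul hV.aemeasurable_exp_neg).const_mul _)
    (fun x _ => by positivity) (fun x _ => by positivity)
    (by
      filter_upwards [ae_restrict_of_ae hf.ae_differentiableAt_real,
        ae_restrict_mem measurableSet_Ioi] with x hx hxA
      have hxA : A ≤ x := le_of_lt hxA
      have hd := hx.hasDerivAt.sub_const (f A)
      have h3 := (hd.fun_mul hd).fun_mul (hV.hasDerivAt_exp_neg hxA)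
      rw [h3.deriv]
      have hp := Real.exp_pos (-V x)
      have hv := hV.le_deriv x hxA
      generalize f x - f A = D
      -- Half of the gain `c D²` absorbs the cross term: `2 D f' ≤ (c/2) D² + (2/c) f'²`.
      have h4 : c * D ^ 2 ≤ deriv V x * D ^ 2 := by gcongr
      have h5 : 0 ≤ (c * D - 2 * deriv f x) ^ 2 / (2 * c) := by positivity
      have e : (c * D - 2 * deriv f x) ^ 2 / (2 * c) =
          c / 2 * D ^ 2 - 2 * D * deriv f x + 2 / c * deriv f x ^ 2 := by
        field_simp
        ring
      rw [e] at h5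
      have h6 : c / 2 * D ^ 2 + 2 * D * deriv f x - deriv V x * D ^ 2 ≤ 2 / c * deriv f x ^ 2 := by
        have : 0 ≤ (c * D - 2 * deriv f x) ^ 2 / (2 * c) := by positivity
        linarith
      have := mul_le_mul_of_nonneg_right h6 hp.le
      linarith)
  simp only [ENNReal.ofReal_mul (by positivity : 0 ≤ c / 2),
    ENNReal.ofReal_mul (by positivity : 0 ≤ 2 / c)] at key
  rw [lintegral_const_mul' _ _ ENNReal.ofReal_ne_top,
    lintegral_const_mul' _ _ ENNReal.ofReal_ne_top] at key
  have e1 : ENNReal.ofReal (2 / c) * ENNReal.ofReal (c / 2) = 1 := by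
    rw [← ENNReal.ofReal_mul (by positivity)]
    have : 2 / c * (c / 2) = 1 := by field_simp
    simp [this]
  have e2 : ENNReal.ofReal (4 / c ^ 2) = ENNReal.ofReal (2 / c) * ENNReal.ofReal (2 / c) := by
    rw [← ENNReal.ofReal_mul (by positivity)]
    congr 1
    field_simp
    norm_num
  have := mul_le_mul_right key (ENNReal.ofReal (2 / c))
  rwa [← mul_assoc, e1, one_mul, ← mul_assoc, ← e2] at this

/-- The pointwise growth bound on a half-line. -/
theorem abs_sub_le (hV : TailPotential Φ θ c K A V) {f : ℝ → ℝ} (hf : LocallyLipschitz f) {τ : ℝ}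
    (hτ : 0 < τ)
    (h : ∫⁻ x in Ioi A, ENNReal.ofReal (deriv f x ^ 2 * Real.exp (-V x)) ≤ ENNReal.ofReal (τ ^ 2))
    {x : ℝ} (hx : A ≤ x) : |f x - f A| ≤ τ * √(Real.exp (V x) / c) := by
  have hc := hV.c_pos
  have hpos : 0 < Real.exp (V x) / c := by positivity
  refine abs_sub_le_of_setLIntegral_deriv_sq_le (p := fun x => Real.exp (-V x)) hx hτ
    (Real.sqrt_pos.2 hpos) (hf.absolutelyContinuousOnInterval A x) (fun x _ => Real.exp_pos _)
    (hV.aemeasurable_exp_neg.mono_measure (Measure.restrict_mono Ioc_subset_Ioi_self le_rfl))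
    ((lintegral_mono_set Ioc_subset_Ioi_self).trans h) ?_
  have hac : AbsolutelyContinuousOnInterval (fun x => Real.exp (V x)) A x := by
    refine ContDiffOn.absolutelyContinuousOnInterval fun y hy => ?_
    rw [uIcc_of_le hx] at hy
    exact (((hV.contDiffAt hy.1).of_le one_le_two).exp).contDiffWithinAt
  -- Since `V' ≥ c`, `e^V` is at most the derivative of `e^V / c`.
  have key := setLIntegral_Ioc_le_of_le_add_deriv hx (hac.const_mul c⁻¹)
    (X := fun x => (Real.exp (-V x))⁻¹) (Y := fun _ => 0) aemeasurable_const
    (fun y _ => by positivity) (fun y _ => le_rfl)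
    (by
      filter_upwards [ae_restrict_mem measurableSet_Ioc] with y hy
      have hy : A ≤ y := hy.1.le
      rw [((hV.hasDerivAt hy).exp.const_mul c⁻¹).deriv, Real.exp_neg, inv_inv, zero_add]
      have := hV.le_deriv y hy
      rw [inv_mul_eq_div, le_div_iff₀ hc]
      gcongr)
  refine key.trans ?_
  rw [Real.sq_sqrt hpos.le]
  simp only [ENNReal.ofReal_zero, lintegral_zero, zero_add]
  refine ENNReal.ofReal_le_ofReal ?_
  have : 0 < c⁻¹ * Real.exp (V A) := by positivity
  rw [div_eq_inv_mul]
  linarith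

end TailPotential

theorem ControlledYoung.locallyLipschitz {Φ : ℝ → ℝ} {θ : ℝ} (h : ControlledYoung Φ θ) :
    LocallyLipschitz Φ := h.young.convex.locallyLipschitz

theorem LocallyLipschitz.max_abs_const {f : ℝ → ℝ} (hf : LocallyLipschitz f) (σ : ℝ) :
    LocallyLipschitz fun x => max |f x| σ := by
  have h1 : LipschitzWith 1 fun x : ℝ => max |x| σ :=
    (lipschitzWith_one_norm (E := ℝ)).max_const σ
  exact h1.locallyLipschitz.comp hf

namespace TailPotential

variable {Φ V : ℝ → ℝ} {θ c K A : ℝ}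

/-- The Hardy inequality with weight `Φ (V')` for a function bounded below. -/
theorem lintegral_young_cutoffSq_le (hV : TailPotential Φ θ c K A V) (hΦ : ControlledYoung Φ θ)
    {n : ℕ} (hn : θ ≤ n) {g : ℝ → ℝ} (hg : LocallyLipschitz g) {σ : ℝ} (hσ : 0 < σ)
    (hgσ : ∀ x, σ ≤ g x) (hgA : g A = σ) :
    ∫⁻ x in Ioi A, ENNReal.ofReal (Φ (deriv V x) * cutoffSq σ n (g x) * Real.exp (-V x)) ≤
      ENNReal.ofReal (2 * θ * (n * (1 / (2 * θ * n)) ^ (-θ))) *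
        ∫⁻ x in Ioi A, ENNReal.ofReal (Φ (|deriv g x| / g x) * g x ^ 2 * Real.exp (-V x)) := by
  have hθ := hΦ.two_lt
  have hn0 : (0 : ℝ) < n := by linarith
  set C : ℝ := n * (1 / (2 * θ * n)) ^ (-θ) with hC
  have hC0 : 0 < C := mul_pos hn0 (Real.rpow_pos_of_pos (by positivity) _)
  have hg0 : ∀ x, 0 < g x := fun x => hσ.trans_le (hgσ x)
  have hu : ∀ b, A ≤ b → AbsolutelyContinuousOnInterval
      (fun x => Φ (deriv V x) * ((deriv V x)⁻¹ * Real.exp (-V x)) * cutoffSq σ n (g x)) A b := by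
    intro b hb
    have h1 : AbsolutelyContinuousOnInterval (fun x => Φ (deriv V x)) A b := by
      have hcd : ContDiffOn ℝ 1 (deriv V) (uIcc A b) := fun x hx => by
        rw [uIcc_of_le hb] at hx
        exact (hV.contDiffAt_deriv hx.1).contDiffWithinAt
      obtain ⟨L, hL⟩ := hcd.exists_lipschitzOnWith (by decide) (convex_Icc _ _) isCompact_Icc
      obtain ⟨L', hL'⟩ := hL.exists_comp_of_locallyLipschitzOn
        (hΦ.locallyLipschitz.locallyLipschitzOn (s := univ)) (mapsTo_univ _ _)
      exact hL'.absolutelyContinuousOnInterval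
    have h2 : AbsolutelyContinuousOnInterval
        (fun x => (deriv V x)⁻¹ * Real.exp (-V x)) A b := by
      refine ContDiffOn.absolutelyContinuousOnInterval fun x hx => ?_
      rw [uIcc_of_le hb] at hx
      exact (((hV.contDiffAt_deriv hx.1).inv (hV.deriv_pos hx.1).ne').mul
        (((hV.contDiffAt hx.1).of_le one_le_two).neg.exp)).contDiffWithinAt
    have h3 : AbsolutelyContinuousOnInterval (fun x => cutoffSq σ n (g x)) A b := by
      obtain ⟨L, hL⟩ := hg.exists_lipschitzOnWith_uIcc A b
      obtain ⟨L', hL'⟩ := hL.exists_comp_of_locallyLipschitzOn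
        ((contDiffOn_cutoffSq σ n).locallyLipschitzOn (convex_Ioi 0)) (fun x _ => hg0 x)
      exact hL'.absolutelyContinuousOnInterval
    exact (h1.fun_mul h2).fun_mul h3
  have hYm : AEMeasurable (fun x => C * (Φ (|deriv g x| / g x) * g x ^ 2 * Real.exp (-V x)))
      (volume.restrict (Ioi A)) := by
    have hgm : Measurable g := hg.continuous.measurable
    have h1 : Measurable fun x => Φ (|deriv g x| / g x) * g x ^ 2 :=
      (hΦ.diff.continuous.measurable.comp ((measurable_deriv g).abs.div hgm)).mul
        (hgm.pow_const 2)
    exact (h1.aemeasurable.mul hV.aemeasurable_exp_neg).const_mul _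
  have key := setLIntegral_Ioi_le_of_add_deriv_le (a := A) hu
    (X := fun x => 1 / (2 * θ) * (Φ (deriv V x) * cutoffSq σ n (g x) * Real.exp (-V x)))
    (Y := fun x => C * (Φ (|deriv g x| / g x) * g x ^ 2 * Real.exp (-V x)))
    (fun b hb => by
      have h1 := cutoffSq_nonneg hσ n (hgσ b)
      have h2 := hV.deriv_pos hb
      have h3 := hΦ.young.nonneg (deriv V b)
      have hn' : n ≠ 0 := by rintro rfl; simp at hn0
      -- The cutoff vanishes at `g A = σ`, which removes the boundary term at `A`.
      have : cutoffSq σ n (g A) = 0 := by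
        rw [hgA, cutoffSq, div_self hσ.ne', sub_self, zero_pow hn', mul_zero]
      simp only [this, mul_zero]
      positivity)
    hYm
    (fun x hx => by
      have h1 := cutoffSq_nonneg hσ n (hgσ x)
      have h3 := hΦ.young.nonneg (deriv V x)
      positivity)
    (fun x hx => by
      have h3 := hΦ.young.nonneg (|deriv g x| / g x)
      positivity)
    (by
      filter_upwards [ae_restrict_of_ae hg.ae_differentiableAt_real,
        ae_restrict_mem measurableSet_Ioi] with x hx hxA
      have hxA : A ≤ x := le_of_lt hxA
      have hy := hV.deriv_pos hxA
      have hd1 : HasDerivAt (fun x => Φ (deriv V x))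
          (deriv Φ (deriv V x) * deriv (deriv V) x) x :=
        (hΦ.diff (deriv V x)).hasDerivAt.comp x (hV.hasDerivAt_deriv hxA)
      have hd2 := ((hV.hasDerivAt_deriv hxA).fun_inv hy.ne').fun_mul (hV.hasDerivAt_exp_neg hxA)
      have hd3 : HasDerivAt (fun x => cutoffSq σ n (g x)) _ x :=
        (hasDerivAt_cutoffSq σ n (hg0 x).ne').comp x hx.hasDerivAt
      rw [((hd1.fun_mul hd2).fun_mul hd3).deriv]
      exact hΦ.hardy_pointwise hn hy (hV.deriv_deriv_le x hxA) hσ (hgσ x) (Real.exp_pos _))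
  have h2θ : 0 < 1 / (2 * θ) := by positivity
  simp only [ENNReal.ofReal_mul h2θ.le, ENNReal.ofReal_mul hC0.le] at key
  rw [lintegral_const_mul' _ _ ENNReal.ofReal_ne_top,
    lintegral_const_mul' _ _ ENNReal.ofReal_ne_top] at key
  have e1 : ENNReal.ofReal (2 * θ) * ENNReal.ofReal (1 / (2 * θ)) = 1 := by
    rw [← ENNReal.ofReal_mul (by positivity)]
    have : 2 * θ * (1 / (2 * θ)) = 1 := by field_simp
    rw [this, ENNReal.ofReal_one]
  have := mul_le_mul_right key (ENNReal.ofReal (2 * θ))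
  rwa [← mul_assoc, e1, one_mul, ← mul_assoc, ← ENNReal.ofReal_mul (by positivity)] at this

end TailPotential

/-! ### Energy comparison and the entropy estimate on a tail -/

/-- Where it is positive, the energy density dominates the squared derivative. -/
theorem ControlledYoung.ae_deriv_sq_le {Φ : ℝ → ℝ} {θ : ℝ} (h : ControlledYoung Φ θ) (f : ℝ → ℝ) :
    ∀ᵐ x, deriv f x ^ 2 ≤ modification Φ (deriv f x / f x) * f x ^ 2 := by
  filter_upwards [ae_deriv_eq_zero_of_eq_zero f] with x hx
  rcases eq_or_ne (f x) 0 with h0 | h0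
  · simp [hx h0, h0]
  · have := mul_le_mul_of_nonneg_right (h.sq_le_modification (deriv f x / f x))
      (sq_nonneg (f x))
    rwa [div_pow, div_mul_cancel₀ _ (by positivity)] at this

/-- The energy density of `max |f| σ` is dominated by that of `f`. -/
theorem ControlledYoung.young_max_abs_le {Φ : ℝ → ℝ} {θ : ℝ} (h : ControlledYoung Φ θ) {f : ℝ → ℝ}
    (hf : Continuous f) {σ : ℝ} (hσ : 0 < σ) (x : ℝ) :
    Φ (|deriv (fun y => max |f y| σ) x| / max |f x| σ) * max |f x| σ ^ 2 ≤
      Φ 1 * (modification Φ (deriv f x / f x) * f x ^ 2) := by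
  rw [deriv_max_abs_const hf hσ]
  split_ifs with hx
  · rw [max_eq_left hx.le, sq_abs, ← abs_div]
    have := mul_le_mul_of_nonneg_right (h.le_modification (deriv f x / f x)) (sq_nonneg (f x))
    linarith
  · rw [zero_div, h.map_zero, zero_mul]
    have := h.pos one_ne_zero
    have := h.modification_nonneg (deriv f x / f x)
    positivity

namespace TailPotential

variable {Φ V : ℝ → ℝ} {θ c K A : ℝ}

/-- The entropy estimate on a half-line. -/
theorem exists_lintegral_entropyGap_le (hV : TailPotential Φ θ c K A V)
    (hΦ : ControlledYoung Φ θ)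
    (hmass : ∫⁻ x in Ioi A, ENNReal.ofReal (Real.exp (-V x)) ≤ 1) (M : ℝ) :
    ∃ C, 0 ≤ C ∧ ∀ (f : ℝ → ℝ), LocallyLipschitz f → ∀ σ τ : ℝ, 0 < τ → τ ≤ σ → |f A| ≤ σ →
      σ ≤ |f A| + M * τ →
      ∫⁻ x in Ioi A, ENNReal.ofReal
        (modification Φ (deriv f x / f x) * f x ^ 2 * Real.exp (-V x)) ≤ ENNReal.ofReal (τ ^ 2) →
      ∫⁻ x in Ioi A, ENNReal.ofReal (entropyGap σ (f x) * Real.exp (-V x)) ≤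
        ENNReal.ofReal (C * τ ^ 2) := by
  have hc := hV.c_pos
  have hK := hV.K_nonneg
  have hθ := hΦ.two_lt
  have hΦ1 := hΦ.pos one_ne_zero
  have hΦc := hΦ.pos hc.ne'
  obtain ⟨n, hn⟩ := exists_nat_ge θ
  set C₂ : ℝ := 2 * θ * (n * (1 / (2 * θ * n)) ^ (-θ)) with hC₂
  have hn0 : (0 : ℝ) < n := by linarith
  have hC₂0 : 0 ≤ C₂ := by
    have : 0 < (1 / (2 * θ * n)) ^ (-θ) := Real.rpow_pos_of_pos (by positivity) _
    positivity
  set C₁ : ℝ := (2 + 2 / c) / Φ c + K with hC₁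
  have hC₁0 : 0 ≤ C₁ := by positivity
  -- The three terms come from the Hardy inequality, from the offset `σ - |f A| ≤ M τ`, and from the
  -- weighted Hardy inequality. The factor `18` is `9 · 2`, from splitting the square.
  refine ⟨18 * (4 / c ^ 2) + 18 * M ^ 2 + C₁ * 2 ^ n * (C₂ * Φ 1), by positivity, ?_⟩
  intro f hf σ τ hτ hτσ hfσ hσM hE
  have hσ : 0 < σ := hτ.trans_le hτσ
  have hE2 : ∫⁻ x in Ioi A, ENNReal.ofReal (deriv f x ^ 2 * Real.exp (-V x)) ≤
      ENNReal.ofReal (τ ^ 2) := by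
    refine (lintegral_mono_ae ?_).trans hE
    filter_upwards [ae_restrict_of_ae (hΦ.ae_deriv_sq_le f)] with x hx
    gcongr
  have hH1 := (hV.lintegral_sub_sq_le hf).trans (by gcongr :
    _ ≤ ENNReal.ofReal (4 / c ^ 2) * ENNReal.ofReal (τ ^ 2))
  have hH2 := hV.lintegral_young_cutoffSq_le hΦ hn (hf.max_abs_const σ) hσ
    (fun x => le_max_right _ _) (max_eq_right hfσ)
  have hE3 : ∫⁻ x in Ioi A, ENNReal.ofReal
      (Φ (|deriv (fun y => max |f y| σ) x| / max |f x| σ) * max |f x| σ ^ 2 * Real.exp (-V x)) ≤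
      ENNReal.ofReal (Φ 1) * ENNReal.ofReal (τ ^ 2) := by
    calc _ ≤ ∫⁻ x in Ioi A, ENNReal.ofReal (Φ 1) * ENNReal.ofReal
          (modification Φ (deriv f x / f x) * f x ^ 2 * Real.exp (-V x)) := by
          refine lintegral_mono fun x => ?_
          rw [← ENNReal.ofReal_mul hΦ1.le]
          refine ENNReal.ofReal_le_ofReal ?_
          have := mul_le_mul_of_nonneg_right (hΦ.young_max_abs_le hf.continuous hσ x)
            (Real.exp_pos (-V x)).le
          linarith
      _ ≤ _ := by
          rw [lintegral_const_mul' _ _ ENNReal.ofReal_ne_top]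
          gcongr
  replace hH2 := hH2.trans (mul_le_mul_right hE3 _)
  -- the pointwise bound
  have hpt : ∀ x ∈ Ioi A, entropyGap σ (f x) * Real.exp (-V x) ≤
      18 * ((f x - f A) ^ 2 * Real.exp (-V x)) + 18 * (M * τ) ^ 2 * Real.exp (-V x) +
      C₁ * 2 ^ n * (Φ (deriv V x) * cutoffSq σ n (max |f x| σ) * Real.exp (-V x)) := by
    intro x hx
    have hx : A ≤ x := le_of_lt hx
    have hp := Real.exp_pos (-V x)
    have hΦy := hΦ.young.nonneg (deriv V x)
    have hcut := cutoffSq_nonneg hσ n (le_max_right |f x| σ)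
    suffices H : entropyGap σ (f x) ≤ 18 * (f x - f A) ^ 2 + 18 * (M * τ) ^ 2 +
        C₁ * 2 ^ n * (Φ (deriv V x) * cutoffSq σ n (max |f x| σ)) by
      have := mul_le_mul_of_nonneg_right H hp.le
      linarith
    rcases le_total (|f x|) (2 * σ) with hle | hge
    · have h1 := entropyGap_le_sq hσ hle
      have h2 : (|f x| - σ) ^ 2 ≤ 2 * (f x - f A) ^ 2 + 2 * (M * τ) ^ 2 := by
        have h3 : (|f x| - σ) ^ 2 ≤ 2 * (|f x| - |f A|) ^ 2 + 2 * (σ - |f A|) ^ 2 := by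
          nlinarith [sq_nonneg ((|f x| - |f A|) + (σ - |f A|))]
        have h4 : (|f x| - |f A|) ^ 2 ≤ (f x - f A) ^ 2 :=
          sq_le_sq.2 (abs_abs_sub_abs_le_abs_sub (f x) (f A))
        have h5 : (σ - |f A|) ^ 2 ≤ (M * τ) ^ 2 := by
          apply pow_le_pow_left₀ <;> linarith
        linarith
      have h6 : 0 ≤ C₁ * 2 ^ n * (Φ (deriv V x) * cutoffSq σ n (max |f x| σ)) := by positivity
      linarith
    · have h1 := entropyGap_le_log hσ hge
      have hfx : 0 < |f x| := by linarith
      have hsq := sq_le_cutoffSq hσ n hge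
      rw [max_eq_left (by linarith : σ ≤ |f x|)] at hcut ⊢
      rw [sq_abs] at hsq
      -- Here `τ ≤ σ` and `|f A| ≤ σ` turn the growth bound into one independent of `f`.
      have h2 : f x ^ 2 / σ ^ 2 ≤ 2 + 2 / c * Real.exp (V x) := by
        rw [div_le_iff₀ (by positivity)]
        have h3 := hV.abs_sub_le hf hτ hE2 hx
        have h4 : (f x - f A) ^ 2 ≤ τ ^ 2 * (Real.exp (V x) / c) := by
          have h5 : 0 ≤ Real.exp (V x) / c := by positivity
          rw [← Real.sq_sqrt h5, ← mul_pow, ← sq_abs]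
          gcongr
        have h5 : f A ^ 2 ≤ σ ^ 2 := by rw [← sq_abs]; gcongr
        have h6 : τ ^ 2 * (Real.exp (V x) / c) ≤ σ ^ 2 * (Real.exp (V x) / c) := by gcongr
        have h7 : f x ^ 2 ≤ 2 * f A ^ 2 + 2 * (f x - f A) ^ 2 := by
          nlinarith [sq_nonneg (f A - (f x - f A))]
        have e : (2 + 2 / c * Real.exp (V x)) * σ ^ 2 =
          2 * σ ^ 2 + 2 * (σ ^ 2 * (Real.exp (V x) / c)) := by ring
        linarith
      have hlog : Real.log (f x ^ 2 / σ ^ 2) ≤ C₁ * Φ (deriv V x) := by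
        have hKΦ : 0 ≤ K * Φ (deriv V x) := by positivity
        have h3 : f x ^ 2 / σ ^ 2 ≤
            Real.exp (2 + 2 / c) * Real.exp (K * Φ (deriv V x)) := by
          have h4 : 2 / c * Real.exp (V x) ≤ 2 / c * Real.exp (K * Φ (deriv V x)) := by
            gcongr
            exact hV.le_young x hx
          have h5 : (1 : ℝ) ≤ Real.exp (K * Φ (deriv V x)) := Real.one_le_exp hKΦ
          have h6 : 2 + 2 / c ≤ Real.exp (2 + 2 / c) := by
            have := Real.add_one_le_exp (2 + 2 / c)
            linarith
          calc f x ^ 2 / σ ^ 2 ≤ (2 + 2 / c) * Real.exp (K * Φ (deriv V x)) := by linarith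
            _ ≤ _ := by gcongr
        have hpos : 0 < f x ^ 2 / σ ^ 2 := by
          rw [← sq_abs (f x)]
          positivity
        have h4 := Real.log_le_log hpos h3
        rw [← Real.exp_add, Real.log_exp] at h4
        -- As `Φ(V')` stays above `Φ c > 0`, the additive constant is absorbed into it.
        have h5 : Φ c ≤ Φ (deriv V x) := hΦ.le_of_le hc.le (hV.le_deriv x hx)
        have h6 : 2 + 2 / c ≤ (2 + 2 / c) / Φ c * Φ (deriv V x) := by
          calc 2 + 2 / c = (2 + 2 / c) / Φ c * Φ c := by field_simp
            _ ≤ _ := by gcongr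
        rw [hC₁, add_mul]
        linarith
      calc entropyGap σ (f x) ≤ f x ^ 2 * (C₁ * Φ (deriv V x)) := h1.trans (by gcongr)
        _ ≤ 2 ^ n * cutoffSq σ n |f x| * (C₁ * Φ (deriv V x)) := by gcongr
        _ = C₁ * 2 ^ n * (Φ (deriv V x) * cutoffSq σ n |f x|) := by ring
        _ ≤ _ := by
          have : 0 ≤ 18 * (f x - f A) ^ 2 + 18 * (M * τ) ^ 2 := by positivity
          linarith
  have hm1 : AEMeasurable (fun x => ENNReal.ofReal ((f x - f A) ^ 2 * Real.exp (-V x)))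
      (volume.restrict (Ioi A)) := by
    have h1 : Measurable fun x => (f x - f A) ^ 2 :=
      (hf.continuous.measurable.sub_const _).pow_const 2
    exact (h1.aemeasurable.mul hV.aemeasurable_exp_neg).ennreal_ofReal
  have hm2 := hV.aemeasurable_exp_neg.ennreal_ofReal
  have hm3 : AEMeasurable (fun x =>
      ENNReal.ofReal 18 * ENNReal.ofReal ((f x - f A) ^ 2 * Real.exp (-V x)) +
        ENNReal.ofReal (18 * (M * τ) ^ 2) * ENNReal.ofReal (Real.exp (-V x)))
      (volume.restrict (Ioi A)) := (hm1.const_mul _).add (hm2.const_mul _)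
  calc ∫⁻ x in Ioi A, ENNReal.ofReal (entropyGap σ (f x) * Real.exp (-V x))
      ≤ ∫⁻ x in Ioi A,
          (ENNReal.ofReal 18 * ENNReal.ofReal ((f x - f A) ^ 2 * Real.exp (-V x)) +
            ENNReal.ofReal (18 * (M * τ) ^ 2) * ENNReal.ofReal (Real.exp (-V x)) +
            ENNReal.ofReal (C₁ * 2 ^ n) * ENNReal.ofReal
              (Φ (deriv V x) * cutoffSq σ n (max |f x| σ) * Real.exp (-V x))) := by
        refine setLIntegral_mono_ae' measurableSet_Ioi (Eventually.of_forall fun x hx => ?_)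
        have h3 := hΦ.young.nonneg (deriv V x)
        have hcut := cutoffSq_nonneg hσ n (le_max_right |f x| σ)
        rw [← ENNReal.ofReal_mul (by positivity), ← ENNReal.ofReal_mul (by positivity),
          ← ENNReal.ofReal_mul (by positivity), ← ENNReal.ofReal_add (by positivity)
          (by positivity), ← ENNReal.ofReal_add (by positivity) (by positivity)]
        exact ENNReal.ofReal_le_ofReal (hpt x hx)
    _ = ENNReal.ofReal 18 * (∫⁻ x in Ioi A,
            ENNReal.ofReal ((f x - f A) ^ 2 * Real.exp (-V x))) +
          ENNReal.ofReal (18 * (M * τ) ^ 2) *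
            (∫⁻ x in Ioi A, ENNReal.ofReal (Real.exp (-V x))) +
          ENNReal.ofReal (C₁ * 2 ^ n) * ∫⁻ x in Ioi A, ENNReal.ofReal
              (Φ (deriv V x) * cutoffSq σ n (max |f x| σ) * Real.exp (-V x)) := by
        rw [lintegral_add_left' hm3,
          lintegral_add_left' (hm1.const_mul _),
          lintegral_const_mul' _ _ ENNReal.ofReal_ne_top,
          lintegral_const_mul' _ _ ENNReal.ofReal_ne_top,
          lintegral_const_mul' _ _ ENNReal.ofReal_ne_top]
    _ ≤ ENNReal.ofReal 18 * (ENNReal.ofReal (4 / c ^ 2) * ENNReal.ofReal (τ ^ 2)) +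
          ENNReal.ofReal (18 * (M * τ) ^ 2) * 1 +
          ENNReal.ofReal (C₁ * 2 ^ n) *
            (ENNReal.ofReal C₂ * (ENNReal.ofReal (Φ 1) * ENNReal.ofReal (τ ^ 2))) := by
        gcongr
    _ = _ := by
        rw [mul_one, ← ENNReal.ofReal_mul (by positivity), ← ENNReal.ofReal_mul (by positivity),
          ← ENNReal.ofReal_mul (by positivity), ← ENNReal.ofReal_mul (by positivity),
          ← ENNReal.ofReal_mul (by positivity), ← ENNReal.ofReal_add (by positivity)
          (by positivity), ← ENNReal.ofReal_add (by positivity) (by positivity)]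
        congr 1
        ring

end TailPotential

/-! ### Gluing the centre and the two tails -/

theorem lintegral_expMeasure_ofReal {V : ℝ → ℝ} (hV : AEMeasurable V volume) {g : ℝ → ℝ}
    (hg : Measurable g) (hg0 : ∀ x, 0 ≤ g x) :
    ∫⁻ x, ENNReal.ofReal (g x) ∂expMeasure V =
      ∫⁻ x, ENNReal.ofReal (g x * Real.exp (-V x)) := by
  have hp : AEMeasurable (fun x => ENNReal.ofReal (Real.exp (-V x))) volume :=
    hV.neg.exp.ennreal_ofReal
  unfold expMeasure
  rw [lintegral_withDensity_eq_lintegral_mul₀ hp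
    hg.ennreal_ofReal.aemeasurable]
  refine lintegral_congr fun x => ?_
  rw [Pi.mul_apply, mul_comm, ← ENNReal.ofReal_mul (hg0 x)]

theorem setLIntegral_Iio_neg (A : ℝ) (q : ℝ → ENNReal) :
    ∫⁻ x in Iio (-A), q x = ∫⁻ x in Ioi A, q (-x) := by
  have h := (Measure.measurePreserving_neg (volume : Measure ℝ)).setLIntegral_comp_preimage_emb
    (Homeomorph.neg ℝ).measurableEmbedding q (Iio (-A))
  rw [← h]
  congr 2
  ext x
  simp

/-- The variational bound for the entropy. -/
theorem entropy_sq_le_of_lintegral_entropyGap_le {μ : Measure ℝ} [IsProbabilityMeasure μ]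
    {f : ℝ → ℝ} (hf : Measurable f) {σ : ℝ} (hσ : 0 < σ) {C : ℝ} (hC : 0 ≤ C)
    (h : ∫⁻ x, ENNReal.ofReal (entropyGap σ (f x)) ∂μ ≤ ENNReal.ofReal C) :
    entropy μ (fun x => f x ^ 2) ≤ (C : EReal) := by
  have hgap0 : 0 ≤ᵐ[μ] fun x => entropyGap σ (f x) :=
    Eventually.of_forall fun x => entropyGap_nonneg hσ (f x)
  have hgap : Integrable (fun x => entropyGap σ (f x)) μ := by
    refine ⟨((measurable_entropyGap σ).comp hf).aestronglyMeasurable, ?_⟩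
    rw [hasFiniteIntegral_iff_ofReal hgap0]
    exact h.trans_lt ENNReal.ofReal_lt_top
  have hgapC : ∫ x, entropyGap σ (f x) ∂μ ≤ C := by
    rw [← ENNReal.ofReal_le_ofReal_iff hC, ofReal_integral_eq_lintegral_ofReal hgap hgap0]
    exact h
  have hsq : Integrable (fun x => f x ^ 2) μ := by
    refine Integrable.mono' ((integrable_const (Real.exp 2 * σ ^ 2)).add hgap)
      (hf.pow_const 2).aestronglyMeasurable (Eventually.of_forall fun x => ?_)
    rw [Real.norm_of_nonneg (sq_nonneg _)]
    exact sq_le_add_entropyGap hσ (f x)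
  have hlog : ∀ x, f x ^ 2 * Real.log (f x ^ 2) =
      entropyGap σ (f x) + ((1 + Real.log (σ ^ 2)) * f x ^ 2 - σ ^ 2) := by
    intro x
    unfold entropyGap
    rcases eq_or_ne (f x) 0 with h0 | h0
    · simp [h0]
    · rw [Real.log_div (by positivity) (by positivity)]
      ring
  have hrest : Integrable (fun x => (1 + Real.log (σ ^ 2)) * f x ^ 2 - σ ^ 2) μ :=
    (hsq.const_mul _).sub (integrable_const _)
  have hint : Integrable (fun x => f x ^ 2 * Real.log (f x ^ 2)) μ := by
    simp only [hlog]
    exact hgap.add hrest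
  unfold entropy
  rw [if_pos ⟨hsq, hint⟩, EReal.coe_le_coe_iff]
  have e1 : ∫ x, f x ^ 2 * Real.log (f x ^ 2) ∂μ =
      (∫ x, entropyGap σ (f x) ∂μ) +
        ((1 + Real.log (σ ^ 2)) * (∫ x, f x ^ 2 ∂μ) - σ ^ 2) := by
    simp only [hlog]
    rw [integral_add hgap hrest, integral_sub (hsq.const_mul _) (integrable_const _),
      integral_const_mul, integral_const]
    simp
  have hN : 0 ≤ ∫ x, f x ^ 2 ∂μ := integral_nonneg fun x => sq_nonneg (f x)
  rw [e1]
  generalize ∫ x, f x ^ 2 ∂μ = N at hN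
  -- This is nonnegativity of the gap at `t = √N`.
  have hfin : (1 + Real.log (σ ^ 2)) * N - σ ^ 2 - N * Real.log N ≤ 0 := by
    have h1 := entropyGap_nonneg hσ (√N)
    unfold entropyGap at h1
    rw [Real.sq_sqrt hN] at h1
    rcases hN.eq_or_lt with rfl | hN
    · simp [sq_nonneg]
    · rw [Real.log_div hN.ne' (by positivity)] at h1
      linarith
  linarith

/-- The modified logarithmic Sobolev inequality for a potential that is locally bounded and
satisfies the tail assumptions on both half-lines. -/
theorem modifiedLogSobolev_of_tailPotential {Φ V : ℝ → ℝ} {θ c K A B : ℝ}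
    (hΦ : ControlledYoung Φ θ) (hVm : AEMeasurable V volume)
    (hprob : IsProbabilityMeasure (expMeasure V)) (hA : 0 < A)
    (hB : ∀ x, |x| ≤ A → |V x| ≤ B)
    (hR : TailPotential Φ θ c K A V) (hL : TailPotential Φ θ c K A fun x => V (-x)) :
    ModifiedLogSobolev (expMeasure V) (modification Φ) := by
  have hmass : ∫⁻ x, ENNReal.ofReal (Real.exp (-V x)) = 1 := by
    have h := lintegral_expMeasure_ofReal hVm (g := fun _ => 1) measurable_const
      fun _ => zero_le_one
    simp only [ENNReal.ofReal_one, lintegral_const, measure_univ, one_mul] at h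
    exact h.symm
  have hmass' : ∀ s : Set ℝ, ∫⁻ x in s, ENNReal.ofReal (Real.exp (-V x)) ≤ 1 := fun s =>
    (setLIntegral_le_lintegral s _).trans hmass.le
  have hpm : AEMeasurable (fun x => Real.exp (-V x)) volume := hVm.neg.exp
  -- `L²` bounds the integral of `e^V` over `[-A, A]`, so `f` varies there by at most `τ L` from `f
  -- A`.
  set L : ℝ := √(2 * A * Real.exp B) with hLdef
  have hL0 : 0 < L := Real.sqrt_pos.2 (by positivity)
  obtain ⟨C₁, hC₁, h₁⟩ := hR.exists_lintegral_entropyGap_le hΦ (hmass' _) (2 * L + 1)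
  obtain ⟨C₂, hC₂, h₂⟩ := hL.exists_lintegral_entropyGap_le hΦ
    (by
      rw [← setLIntegral_Iio_neg A fun x => ENNReal.ofReal (Real.exp (-V x))]
      exact hmass' _) (2 * L + 1)
  set C : ℝ := C₂ + 9 * (2 * L + 1) ^ 2 + C₁ with hC
  have hC0 : 0 < C := by positivity
  -- Only an upper bound `τ² > 0` on the energy is fixed, so that zero energy is reached by a limit.
  have main : ∀ f : ℝ → ℝ, LocallyLipschitz f → ∀ τ : ℝ, 0 < τ →
      ∫⁻ x, ENNReal.ofReal (modification Φ (deriv f x / f x) * f x ^ 2) ∂expMeasure V ≤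
        ENNReal.ofReal (τ ^ 2) →
      entropy (expMeasure V) (fun x => f x ^ 2) ≤ ((C * τ ^ 2 : ℝ) : EReal) := by
    intro f hf τ hτ hE
    have hfm : Measurable f := hf.continuous.measurable
    have hHm : Measurable fun x => modification Φ (deriv f x / f x) * f x ^ 2 :=
      (hΦ.measurable_modification.comp ((measurable_deriv f).div hfm)).mul (hfm.pow_const 2)
    rw [lintegral_expMeasure_ofReal hVm hHm
      fun x => mul_nonneg (hΦ.modification_nonneg _) (sq_nonneg _)] at hE
    have hE2 : ∫⁻ x, ENNReal.ofReal (deriv f x ^ 2 * Real.exp (-V x)) ≤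
        ENNReal.ofReal (τ ^ 2) := by
      refine (lintegral_mono_ae ?_).trans hE
      filter_upwards [hΦ.ae_deriv_sq_le f] with x hx
      gcongr
    have hosc : ∀ y ∈ Icc (-A) A, |f A - f y| ≤ τ * L := by
      intro y hy
      refine abs_sub_le_of_setLIntegral_deriv_sq_le (p := fun x => Real.exp (-V x)) hy.2 hτ hL0
        (hf.absolutelyContinuousOnInterval y A) (fun x _ => Real.exp_pos _)
        hpm.restrict ((setLIntegral_le_lintegral _ _).trans hE2) ?_
      calc ∫⁻ x in Ioc y A, ENNReal.ofReal ((Real.exp (-V x))⁻¹)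
          ≤ ∫⁻ x in Ioc y A, ENNReal.ofReal (Real.exp B) := by
            refine setLIntegral_mono_ae' measurableSet_Ioc (Eventually.of_forall fun x hx => ?_)
            rw [Real.exp_neg, inv_inv]
            gcongr
            exact (le_abs_self _).trans
              (hB x (abs_le.2 ⟨hy.1.trans hx.1.le, hx.2⟩))
        _ = ENNReal.ofReal (Real.exp B * (A - y)) := by
            rw [setLIntegral_const, Real.volume_Ioc, ← ENNReal.ofReal_mul (Real.exp_pos _).le]
        _ ≤ ENNReal.ofReal (L ^ 2) := by
            refine ENNReal.ofReal_le_ofReal ?_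
            rw [hLdef, Real.sq_sqrt (by positivity)]
            have := Real.exp_pos B
            nlinarith [hy.1]
    -- The part `L τ` gives `|f| ≤ σ` on `[-A, A]`; the extra `τ` gives `σ ≥ τ > 0` even if `f A =
    -- 0`. In total `σ` exceeds `|f|` there by at most `(L + 1) τ + L τ`.
    set σ : ℝ := |f A| + (L + 1) * τ with hσdef
    have hτσ : τ ≤ σ := by
      have := abs_nonneg (f A)
      nlinarith
    have hσ : 0 < σ := hτ.trans_le hτσ
    have hup : ∀ y ∈ Icc (-A) A, |f y| ≤ σ := by
      intro y hy
      have h1 := hosc y hy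
      rw [abs_sub_comm] at h1
      have h2 := (abs_sub_abs_le_abs_sub (f y) (f A)).trans h1
      rw [hσdef]
      linarith
    have hlow : ∀ y ∈ Icc (-A) A, σ ≤ |f y| + (2 * L + 1) * τ := by
      intro y hy
      have h2 := (abs_sub_abs_le_abs_sub (f A) (f y)).trans (hosc y hy)
      rw [hσdef]
      linarith
    have hAm : A ∈ Icc (-A) A := ⟨by linarith, le_rfl⟩
    have hAm' : -A ∈ Icc (-A) A := ⟨le_rfl, by linarith⟩
    refine entropy_sq_le_of_lintegral_entropyGap_le hfm hσ (by positivity) ?_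
    rw [lintegral_expMeasure_ofReal hVm (g := fun x => entropyGap σ (f x))
      ((measurable_entropyGap σ).comp hfm) fun x => entropyGap_nonneg hσ _]
    have hright := h₁ f hf σ τ hτ hτσ (hup A hAm) (hlow A hAm)
      ((setLIntegral_le_lintegral _ _).trans hE)
    have hleft : ∫⁻ x in Iio (-A), ENNReal.ofReal (entropyGap σ (f x) * Real.exp (-V x)) ≤
        ENNReal.ofReal (C₂ * τ ^ 2) := by
      rw [setLIntegral_Iio_neg]
      refine h₂ (fun x => f (-x)) (hf.comp LipschitzWith.id.neg.locallyLipschitz) σ τ hτ hτσ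
        (hup _ hAm') (hlow _ hAm') ?_
      -- The energy is invariant under reflection because `H_Φ` is even.
      simp only [deriv_comp_neg, neg_div, modification_neg]
      rw [← setLIntegral_Iio_neg A fun x =>
        ENNReal.ofReal (modification Φ (deriv f x / f x) * f x ^ 2 * Real.exp (-V x))]
      exact (setLIntegral_le_lintegral _ _).trans hE
    have hcenter : ∫⁻ x in Icc (-A) A, ENNReal.ofReal (entropyGap σ (f x) * Real.exp (-V x)) ≤
        ENNReal.ofReal (9 * (2 * L + 1) ^ 2 * τ ^ 2) := by
      calc _ ≤ ∫⁻ x in Icc (-A) A, ENNReal.ofReal (9 * (2 * L + 1) ^ 2 * τ ^ 2) *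
            ENNReal.ofReal (Real.exp (-V x)) := by
            refine setLIntegral_mono_ae' measurableSet_Icc (Eventually.of_forall fun x hx => ?_)
            rw [← ENNReal.ofReal_mul (by positivity)]
            refine ENNReal.ofReal_le_ofReal ?_
            gcongr
            have h1 := hup x hx
            have h2 := hlow x hx
            have h3 : (σ - |f x|) ^ 2 ≤ ((2 * L + 1) * τ) ^ 2 := by
              apply pow_le_pow_left₀ <;> linarith
            have h4 := entropyGap_le_sq hσ (t := f x) (by linarith)
            nlinarith
        _ ≤ _ := by
            rw [lintegral_const_mul' _ _ ENNReal.ofReal_ne_top]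
            exact mul_le_of_le_one_right' (hmass' _)
    have hcover : (univ : Set ℝ) = Iio (-A) ∪ Icc (-A) A ∪ Ioi A := by
      ext x
      simp only [mem_univ, mem_union, mem_Iio, mem_Icc, mem_Ioi, true_iff]
      rcases lt_or_ge x (-A) with h | h
      · exact Or.inl (Or.inl h)
      · rcases le_or_gt x A with h' | h'
        · exact Or.inl (Or.inr ⟨h, h'⟩)
        · exact Or.inr h'
    rw [← setLIntegral_univ, hcover]
    refine (lintegral_union_le _ _ _).trans ((add_le_add_left (lintegral_union_le _ _ _) _).trans
      ((add_le_add (add_le_add hleft hcenter) hright).trans (le_of_eq ?_)))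
    rw [← ENNReal.ofReal_add (by positivity) (by positivity),
      ← ENNReal.ofReal_add (by positivity) (by positivity)]
    congr 1
    rw [hC]
    ring
  refine ⟨C, hC0, fun f hf => ?_⟩
  set E := ∫⁻ x, ENNReal.ofReal (modification Φ (deriv f x / f x) * f x ^ 2) ∂expMeasure V with hE
  by_cases hfin : E = ⊤
  · rw [hfin, ENNReal.mul_top (by simpa using hC0)]
    exact le_top
  lift E to NNReal using hfin with e
  have hcoe : ((ENNReal.ofReal C * (e : ENNReal) : ENNReal) : EReal) = ((C * e : ℝ) : EReal) := by
    rw [← ENNReal.ofReal_coe_nnreal, ← ENNReal.ofReal_mul hC0.le, EReal.coe_ennreal_ofReal,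
      max_eq_left (by positivity)]
  -- Every real `z > C e` is shown to be an upper bound, using `τ² = z / C`.
  rw [hcoe, ← EReal.le_of_forall_lt_iff_le]
  intro z hz
  rw [EReal.coe_lt_coe_iff] at hz
  have hz0 : (e : ℝ) < z / C := by rwa [lt_div_iff₀ hC0, mul_comm]
  have hzC : 0 < z / C := e.2.trans_lt hz0
  have := main f hf (√(z / C)) (Real.sqrt_pos.2 hzC) (by
    rw [← hE, Real.sq_sqrt hzC.le, ← ENNReal.ofReal_coe_nnreal]
    exact ENNReal.ofReal_le_ofReal hz0.le)
  rwa [Real.sq_sqrt hzC.le, mul_div_cancel₀ _ hC0.ne'] at this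

/-! ### From the asymptotic assumptions to tail bounds -/

theorem mainTheorem7
    (Φ : ℝ → ℝ) (hΦ : IsNiceYoung Φ) (hconv : StrictConvexOn ℝ univ Φ)
    (hdiff : Differentiable ℝ Φ)
    (hmono : MonotoneOn (fun x : ℝ => Φ x / x ^ 2) (Ioi 0))
    (θ : ℝ) (hθ : 2 < θ)
    (hanti : AntitoneOn (fun x : ℝ => Φ x / x ^ θ) (Ioi 0))
    (V : ℝ → ℝ) (hVmeas : AEMeasurable V volume)
    (hprob : IsProbabilityMeasure (expMeasure V))
    (hVbdd : ∀ R : ℝ, ∃ C : ℝ, ∀ x : ℝ, |x| ≤ R → |V x| ≤ C)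
    (hVsmooth : ∃ A : ℝ, ContDiffOn ℝ 2 V (Ioi A) ∧ ContDiffOn ℝ 2 V (Iio (-A)))
    (h₁ : 0 < liminf (fun x : ℝ => ((Real.sign x * deriv V x : ℝ) : EReal)) (cocompact ℝ))
    (h₂ : ((-1 : ℝ) : EReal) <
      liminf (fun x : ℝ => ((deriv (deriv V) x / deriv V x ^ 2 : ℝ) : EReal)) (cocompact ℝ))
    (h₃ : limsup (fun x : ℝ => ((deriv (deriv V) x / deriv V x ^ 2 : ℝ) : EReal)) (cocompact ℝ) <
      ((1 / θ : ℝ) : EReal))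
    (h₄ : limsup (fun x : ℝ => ((V x / Φ |deriv V x| : ℝ) : EReal)) (cocompact ℝ) < ⊤) :
    ModifiedLogSobolev (expMeasure V) (modification Φ) := by
  have hY : ControlledYoung Φ θ := ⟨hΦ, hdiff, hmono, hθ, hanti⟩
  obtain ⟨c, hc0, hc⟩ := EReal.lt_iff_exists_real_btwn.1 h₁
  have hc0 : 0 < c := by exact_mod_cast hc0
  obtain ⟨K, hK, -⟩ := EReal.lt_iff_exists_real_btwn.1 h₄
  obtain ⟨A₁, hs₁, hs₂⟩ := hVsmooth
  have hev := (eventually_lt_of_lt_liminf hc).and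
    ((eventually_lt_of_limsup_lt h₃).and (eventually_lt_of_limsup_lt hK))
  rw [← Metric.cobounded_eq_cocompact, hasBasis_cobounded_norm.eventually_iff] at hev
  obtain ⟨R, -, hev⟩ := hev
  simp only [mem_ofPred_eq, Real.norm_eq_abs, EReal.coe_lt_coe_iff] at hev
  -- The added `1` makes `A > A₁` strict, so `V` is smooth around `A` itself, and `A > 0`.
  set A : ℝ := max (max R A₁) 0 + 1 with hA
  have hR : R < A := by
    have := (le_max_left R A₁).trans (le_max_left _ 0)
    linarith
  have hA₁ : A₁ < A := by
    have := (le_max_right R A₁).trans (le_max_left _ 0)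
    linarith
  have hA0 : 0 < A := by
    have := le_max_right (max R A₁) 0
    linarith
  obtain ⟨B, hB⟩ := hVbdd A
  have hbound : ∀ x, A ≤ |x| → c ≤ Real.sign x * deriv V x ∧
      deriv (deriv V) x ≤ deriv V x ^ 2 / θ ∧ V x ≤ max K 0 * Φ |deriv V x| := by
    intro x hx
    obtain ⟨h1, h2, h3⟩ := hev (hR.le.trans hx)
    have hne : deriv V x ≠ 0 := by
      intro h0
      rw [h0, mul_zero] at h1
      exact absurd h1 (not_lt.2 hc0.le)
    have hpos := hY.pos (abs_ne_zero.2 hne)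
    refine ⟨h1.le, ?_, ?_⟩
    · rw [div_lt_iff₀ (by positivity)] at h2
      rw [div_eq_mul_one_div, mul_comm]
      exact h2.le
    · rw [div_lt_iff₀ hpos] at h3
      exact h3.le.trans (by gcongr; exact le_max_left _ _)
  -- The left tail is the right tail of `x ↦ V (-x)`; `max K 0` supplies a nonnegative constant.
  refine modifiedLogSobolev_of_tailPotential (c := c) (K := max K 0) hY hVmeas hprob hA0 hB
    ⟨hc0, le_max_right _ _, ⟨A₁, hA₁, hs₁⟩, ?_, ?_, ?_⟩
    ⟨hc0, le_max_right _ _, ⟨A₁, hA₁, ?_⟩, ?_, ?_, ?_⟩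
  · intro x hx
    have := (hbound x (hx.trans (le_abs_self x))).1
    rwa [Real.sign_of_pos (hA0.trans_le hx), one_mul] at this
  · intro x hx
    exact (hbound x (hx.trans (le_abs_self x))).2.1
  · intro x hx
    rw [← hY.map_abs]
    exact (hbound x (hx.trans (le_abs_self x))).2.2
  · exact hs₂.comp contDiff_neg.contDiffOn fun x hx => by simpa using hx
  · intro x hx
    have := (hbound (-x) (by rw [abs_neg]; exact hx.trans (le_abs_self x))).1
    rw [Real.sign_of_neg (neg_neg_of_pos (hA0.trans_le hx))] at this
    rw [deriv_comp_neg]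
    linarith
  · intro x hx
    have := (hbound (-x) (by rw [abs_neg]; exact hx.trans (le_abs_self x))).2.1
    have e : deriv (fun x => V (-x)) = fun x => -deriv V (-x) := funext fun x => deriv_comp_neg V x
    rw [e, deriv.fun_neg, deriv_comp_neg, neg_neg, neg_sq]
    exact this
  · intro x hx
    have := (hbound (-x) (by rw [abs_neg]; exact hx.trans (le_abs_self x))).2.2
    rw [deriv_comp_neg, ← hY.map_abs, abs_neg]
    exact this
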